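/- Let $B$ be the ring of germs at $+\infty$ of real-valued functions, that is, of real-valued functions defined on some half-line $(c,\infty)$, where two functions are identified if they agree for all sufficiently large arguments. A Hardy field is a subfield of $B$ that is closed under differentiation (so its elements are differentiable for all sufficiently large arguments). Let $a\colon\mathbb{R}\to\mathbb{R}$ be a function whose germ at $+\infty$ belongs to some Hardy field, and suppose that $a$ has polynomial growth, meaning that $a(t)/t^k\to 0$ as $t\to+\infty$ for some $k\in\mathbb{N}$. Then the sequence $(a(n) \bmod 1)_{n\ge 1}$ is equidistributed in $\mathbb{T}=\mathbb{R}/\mathbb{Z}$, meaning that $$\lim_{N\to\infty}\frac1N\sum_{n=1}^N F(a(n) \bmod 1)=\int_{\mathbb{T}}F\,dm_{\mathbb{T}}\qquad\text{for every continuous } F\colon\mathbb{T}\to\mathbb{C},$$ where $m_{\mathbb{T}}$ is the normalized Haar measure, if and only if for every polynomial $p$ with rational coefficients one has $|a(t)-p(t)|\succ\log t$, meaning that $a(t)-p(t)\neq 0$ for all sufficiently large $t$ and $\log t/|a(t)-p(t)|\to 0$ as $t\to+\infty$. -/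

import Mathlib

open Filter Asymptotics

/-- A Hardy field: a subfield of the ring of germs at `+∞` of real valued functions
(two functions are identified if they agree eventually) that is closed under differentiation.
The second condition says that every function with germ in `K` is differentiable at all
sufficiently large reals, and that the germ of its derivative lies in `K`. -/
structure IsHardyField (K : Subring (Germ (atTop : Filter ℝ) ℝ)) : Prop where
  isField : IsField K
  deriv_mem : ∀ f : ℝ → ℝ, (f : Germ (atTop : Filter ℝ) ℝ) ∈ K →
    (∀ᶠ t in atTop, DifferentiableAt ℝ f t) ∧
      ((deriv f : ℝ → ℝ) : Germ (atTop : Filter ℝ) ℝ) ∈ K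

/-- A Hardy function: a function whose germ at `+∞` belongs to some Hardy field. -/
def IsHardyFunction (a : ℝ → ℝ) : Prop :=
  ∃ K : Subring (Germ (atTop : Filter ℝ) ℝ),
    IsHardyField K ∧ (a : Germ (atTop : Filter ℝ) ℝ) ∈ K

/-- Polynomial growth: `a(t) / t ^ k → 0` as `t → +∞`, for some natural number `k`. -/
def HasPolynomialGrowth (a : ℝ → ℝ) : Prop :=
  ∃ k : ℕ, a =o[atTop] (fun t : ℝ => t ^ k)

/-- The sequence `u 1, u 2, …` is equidistributed in `X` with respect to `μ`: for every continuous
`F : X → ℂ` the averages of `F (u n)` over `1 ≤ n ≤ N` converge to the integral of `F`. -/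
def IsEquidistributed {X : Type*} [TopologicalSpace X] [MeasurableSpace X]
    (u : ℕ → X) (μ : MeasureTheory.Measure X) : Prop :=
  ∀ F : C(X, ℂ), Tendsto (fun N : ℕ => (1 / (N : ℂ)) * ∑ n ∈ Finset.Icc 1 N, F (u n))
    atTop (nhds (∫ x, F x ∂μ))

/-!
Let `a` be an element of a Hardy field, of polynomial growth.

**Hardy fields.** The polynomials in the identity function `t` with coefficients in a Hardy field
form a ring of functions that are eventually zero, eventually positive or eventually negative:
divide such a polynomial by its leading coefficient and differentiate; the degree drops, and a
function whose derivative has an eventual sign has one too (`eventuallySigned_aeval`,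
`exists_isHardyRing`). In such a ring `S` every element has a limit in `[-∞, ∞]`, and everything
that follows about the growth of `f` in `S` is read off from the sign of an element such as
`t * f' - C` or `t ^ 9 * f' ^ 8 - 1`. In particular `f` either grows faster than the logarithm, or
satisfies `|t * f'| ≤ C` eventually (`IsHardyRing.log_isLittleO_or_bounded`).

**Necessity.** If `f = a - p` satisfies `|t * f'| ≤ C` for a rational polynomial `p`, choose `q`
such that `p` is constant modulo `1` on the multiples of `q`. On the multiples of `q` in a block
`(s * K, (s + 1) * K]` the function `a` then varies modulo `1` by at most `C / s`. So a proportion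
`1 / q` of the block is mapped into a short arc, which contradicts equidistribution if `s` is large
(`not_isEquidistributed_of_abs_mul_deriv_le`).

**Sufficiency.** By Weyl's criterion it is enough to show that the means of `exp (2πi f(n))` tend to
zero for `f` in `S` of polynomial growth whose difference from each rational polynomial grows faster
than the logarithm. Let `k` be minimal such that the `k`-th derivative of `f` has a finite limit
`c`; then `k ≥ 1`, because `f` is unbounded. If `c` is irrational, differencing `k - 1` times by
van der Corput's theorem reduces to a sequence with differences tending to an irrational limit,
where the claim is elementary. If `c` is rational, subtract `c * t ^ k / k!`, which costs only a
periodic factor, and hence twists by rational frequencies. Thereby the `k`-th derivative may be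
assumed to tend to zero, and either `k` decreases or the derivative `G` of order `k - 1` is
unbounded.
* For `k = 1`, faster growth than the logarithm means `t * f' → ∞`. This is Fejér's condition, and
  the inequality of Kusmin and Landau applies (`norm_sum_ex_le_of_antitone`).
* For `k ≥ 2`, Fejér's condition on `g = G'` still suffices, by van der Corput differencing. But
  for `f = t * log (log t)`, say, it fails, and differencing by fixed shifts down to first
  differences loses too much. Say `g > 0`. Since `G` is unbounded, `g` is at least `t ^ (-9/8)`;
  and if `g ≤ t ^ (-3/4)`, then, after differencing `k - 2` times, van der Corput's inequality with
  about `N ^ (1/4)` shifts, combined with the inequality of Kusmin and Landau for each shift, gives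
  the claim (`norm_sum_ex_sq_le`).

Only finite differences of the sequence `f n` enter the estimates of exponential sums; the mean
value theorem relates them to the derivatives of `f`.
-/

namespace HardyEquidistribution

open scoped fwdDiff ComplexConjugate

/-! ### Exponential sums -/

/-- The character `x ↦ exp (2πix)` of `ℝ / ℤ`, as a function on the real line. -/
noncomputable def ex (x : ℝ) : ℂ := Complex.exp (2 * Real.pi * x * Complex.I)

lemma ex_add (x y : ℝ) : ex (x + y) = ex x * ex y := by
  simp only [ex, ← Complex.exp_add]; congr 1; push_cast; ring

lemma norm_ex (x : ℝ) : ‖ex x‖ = 1 := by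
  have : (2 * Real.pi * x * Complex.I : ℂ) = ((2 * Real.pi * x : ℝ) : ℂ) * Complex.I := by
    push_cast; ring
  rw [ex, this, Complex.norm_exp_ofReal_mul_I]

lemma conj_ex (x : ℝ) : conj (ex x) = ex (-x) := by
  rw [ex, ex, ← Complex.exp_conj]; congr 1
  have : conj (2 : ℂ) = 2 := Complex.conj_ofNat 2
  simp [this]

lemma ex_sub (x y : ℝ) : ex (x - y) = ex x * conj (ex y) := by
  rw [conj_ex, ← ex_add, sub_eq_add_neg]

lemma ex_int (z : ℤ) : ex z = 1 := by
  rw [ex, Complex.exp_eq_one_iff]; exact ⟨z, by push_cast; ring⟩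

lemma ex_eq_one_iff (x : ℝ) : ex x = 1 ↔ ∃ z : ℤ, x = z := by
  refine ⟨fun h => ?_, fun ⟨z, hz⟩ => by rw [hz, ex_int]⟩
  rw [ex, Complex.exp_eq_one_iff] at h
  obtain ⟨z, hz⟩ := h
  refine ⟨z, ?_⟩
  have h2 : (2 * Real.pi * Complex.I : ℂ) ≠ 0 := Complex.two_pi_I_ne_zero
  have : ((x : ℂ)) = z := mul_left_cancel₀ h2 (by rw [mul_comm _ (z : ℂ), ← hz]; ring)
  exact_mod_cast this

lemma continuous_ex : Continuous ex := by unfold ex; fun_prop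

lemma norm_ex_sub_one (x : ℝ) : ‖ex x - 1‖ = 2 * |Real.sin (Real.pi * x)| := by
  have := Complex.norm_exp_I_mul_ofReal_sub_one (2 * Real.pi * x)
  rw [show (2 * Real.pi * x : ℝ) / 2 = Real.pi * x by ring, norm_mul] at this
  rw [ex, ← Real.norm_eq_abs, show (2 * Real.pi * x * Complex.I : ℂ)
    = Complex.I * ((2 * Real.pi * x : ℝ) : ℂ) by push_cast; ring, this]
  simp

lemma le_norm_ex_sub_one {x : ℝ} (h0 : 0 ≤ x) (h1 : x ≤ 1 / 2) : 4 * x ≤ ‖ex x - 1‖ := by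
  have hpi := Real.pi_pos
  rw [norm_ex_sub_one]
  have := Real.mul_le_sin (x := Real.pi * x) (by positivity) (by nlinarith)
  have h3 : 2 / Real.pi * (Real.pi * x) = 2 * x := by field_simp
  have := le_abs_self (Real.sin (Real.pi * x))
  linarith

lemma norm_ex_sub_ex_le (x y : ℝ) : ‖ex x - ex y‖ ≤ 2 * Real.pi * |x - y| := by
  have h : ex x - ex y = ex y * (ex (x - y) - 1) := by
    rw [mul_sub, ← ex_add]; simp
  rw [h, norm_mul, norm_ex, one_mul, norm_ex_sub_one]
  have := Real.abs_sin_le_one (Real.pi * (x - y))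
  have h2 : |Real.sin (Real.pi * (x - y))| ≤ |Real.pi * (x - y)| := Real.abs_sin_le_abs
  rw [abs_mul, abs_of_pos Real.pi_pos] at h2
  linarith

/-- The inequality of Kusmin and Landau: if the differences of a real sequence decrease on `[m, M]`
and stay in `(0, 1/2]`, then the exponential sum over `[m, M)` is at most the reciprocal of the
last difference. With `w = 1 / (ex θ - 1)` one has `ex (y n) = (ex (y (n+1)) - ex (y n)) * w n`,
so this is summation by parts; the total variation of `w` telescopes. -/
lemma norm_sum_ex_le_of_antitone {y : ℕ → ℝ} {m M : ℕ} (hmM : m ≤ M)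
    (hanti : ∀ n, m ≤ n → n < M → Δ_[1] y (n + 1) ≤ Δ_[1] y n)
    (hpos : 0 < Δ_[1] y M) (hhalf : Δ_[1] y m ≤ 1 / 2) :
    ‖∑ n ∈ Finset.Ico m M, ex (y n)‖ ≤ 1 / Δ_[1] y M := by
  set θ : ℕ → ℝ := Δ_[1] y with hθ
  set w : ℕ → ℂ := fun n => (ex (θ n) - 1)⁻¹ with hw
  have hup : ∀ n, m ≤ n → n ≤ M → θ n ≤ 1 / 2 := by
    intro n hn
    induction n, hn using Nat.le_induction with
    | base => intro _; exact hhalf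
    | succ n hn ih => intro h; exact (hanti n hn (by omega)).trans (ih (by omega))
  have hlow : ∀ n, m ≤ n → n ≤ M → 0 < θ n := by
    intro n hn hnM
    induction hnM using Nat.decreasingInduction with
    | of_succ k hk ih => exact (ih (by omega)).trans_le (hanti k hn hk)
    | self => exact hpos
  have hwb : ∀ n, m ≤ n → n ≤ M → ‖w n‖ ≤ 1 / (4 * θ n) := by
    intro n h1 h2
    have := le_norm_ex_sub_one (hlow n h1 h2).le (hup n h1 h2)
    have h3 := hlow n h1 h2
    rw [hw, norm_inv, ← one_div]
    exact one_div_le_one_div_of_le (by positivity) this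
  have hne : ∀ n, m ≤ n → n ≤ M → ex (θ n) - 1 ≠ 0 := by
    intro n h1 h2 h
    have := le_norm_ex_sub_one (hlow n h1 h2).le (hup n h1 h2)
    have h3 := hlow n h1 h2
    rw [h, norm_zero] at this
    linarith
  have hdiff : ∀ n, m ≤ n → n < M → ‖w n - w (n + 1)‖ ≤ 1 / (2 * θ (n + 1)) - 1 / (2 * θ n) := by
    intro n h1 h2
    have ha := hne n h1 h2.le
    have hb := hne (n + 1) (by omega) h2
    have hla := hlow n h1 h2.le
    have hlb := hlow (n + 1) (by omega) h2
    have : w n - w (n + 1) = (ex (θ (n + 1)) - ex (θ n)) * w n * w (n + 1) := by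
      simp only [hw]; field_simp; ring
    rw [this, norm_mul, norm_mul]
    have hle := norm_ex_sub_ex_le (θ (n + 1)) (θ n)
    have habs : |θ (n + 1) - θ n| = θ n - θ (n + 1) := by
      rw [abs_sub_comm, abs_of_nonneg]; linarith [hanti n h1 h2]
    have hpi : Real.pi ≤ 4 := Real.pi_le_four
    have hnn : 0 ≤ θ n - θ (n + 1) := by linarith [hanti n h1 h2]
    calc ‖ex (θ (n + 1)) - ex (θ n)‖ * ‖w n‖ * ‖w (n + 1)‖
        ≤ (2 * 4 * (θ n - θ (n + 1))) * (1 / (4 * θ n)) * (1 / (4 * θ (n + 1))) := by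
          gcongr
          · rw [habs] at hle; exact hle.trans (by gcongr)
          · exact hwb n h1 h2.le
          · exact hwb (n + 1) (by omega) h2
      _ = 1 / (2 * θ (n + 1)) - 1 / (2 * θ n) := by field_simp; ring
  have key : ∀ n, m ≤ n → n ≤ M → ‖∑ k ∈ Finset.Ico m n, ex (y k) - ex (y n) * w n‖
      ≤ 1 / (4 * θ m) + (1 / (2 * θ n) - 1 / (2 * θ m)) := by
    intro n hn
    induction n, hn using Nat.le_induction with
    | base => intro h; simpa [norm_ex] using hwb m le_rfl h
    | succ n hn ih =>
      intro h
      have h1 := hne n hn (by omega)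
      have h2 : ex (y (n + 1)) = ex (y n) * ex (θ n) := by
        rw [← ex_add]; simp [hθ, fwdDiff]
      have h3 : ex (y n) = ex (y (n + 1)) * w n - ex (y n) * w n := by
        rw [h2]; simp only [hw]; field_simp
      have h4 : ∑ k ∈ Finset.Ico m (n + 1), ex (y k) - ex (y (n + 1)) * w (n + 1)
          = (∑ k ∈ Finset.Ico m n, ex (y k) - ex (y n) * w n)
            + ex (y (n + 1)) * (w n - w (n + 1)) := by
        rw [Finset.sum_Ico_succ_top hn]
        linear_combination h3
      rw [h4]
      refine (norm_add_le _ _).trans ?_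
      rw [norm_mul, norm_ex, one_mul]
      linarith [ih (by omega), hdiff n hn (by omega)]
  have hM := key M hmM le_rfl
  have hm0 := hlow m le_rfl hmM
  have hwM := hwb M hmM le_rfl
  have htri : ‖∑ k ∈ Finset.Ico m M, ex (y k)‖
      ≤ ‖∑ k ∈ Finset.Ico m M, ex (y k) - ex (y M) * w M‖ + ‖ex (y M) * w M‖ := by
    simpa using norm_add_le (∑ k ∈ Finset.Ico m M, ex (y k) - ex (y M) * w M) (ex (y M) * w M)
  rw [norm_mul, norm_ex, one_mul] at htri
  have e1 : 1 / (4 * θ m) = 1 / θ m / 4 := by field_simp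
  have e2 : 1 / (2 * θ m) = 1 / θ m / 2 := by field_simp
  have e3 : 1 / (4 * θ M) = 1 / θ M / 4 := by field_simp
  have e4 : 1 / (2 * θ M) = 1 / θ M / 2 := by field_simp
  have p1 : 0 < 1 / θ m := by positivity
  have p2 : 0 < 1 / θ M := by positivity
  rw [e1, e2, e4] at hM
  rw [e3] at hwM
  linarith

/-- The averages `(1 / N) ∑ n < N, u n` tend to zero. -/
def HasMeanZero (u : ℕ → ℂ) : Prop :=
  (fun N : ℕ => ∑ n ∈ Finset.range N, u n) =o[atTop] (fun N : ℕ => (N : ℝ))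

lemma norm_sum_le_card {v : ℕ → ℂ} (hv : ∀ n, ‖v n‖ ≤ 1) (s : Finset ℕ) :
    ‖∑ n ∈ s, v n‖ ≤ s.card := by
  simpa using norm_sum_le_of_le s (fun n _ => hv n)

lemma norm_sum_shift_sub_sum_le {v : ℕ → ℂ} (hv : ∀ n, ‖v n‖ ≤ 1) (N h : ℕ) :
    ‖∑ n ∈ Finset.range N, v (n + h) - ∑ n ∈ Finset.range N, v n‖ ≤ 2 * h := by
  have h1 := Finset.sum_range_add v h N
  have h2 := Finset.sum_range_add v N h
  rw [add_comm N h, h1] at h2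
  have h3 : ∑ n ∈ Finset.range N, v (n + h) - ∑ n ∈ Finset.range N, v n
      = ∑ x ∈ Finset.range h, v (N + x) - ∑ n ∈ Finset.range h, v n := by
    simp only [add_comm _ h]
    linear_combination h2
  rw [h3]
  refine (norm_sub_le _ _).trans ?_
  have a := norm_sum_le_card (v := fun x => v (N + x)) (fun n => hv _) (Finset.range h)
  have b := norm_sum_le_card hv (Finset.range h)
  simp only [Finset.card_range] at a b
  linarith

lemma sum_dist_le {c : ℕ → ℝ} (hc : ∀ n, 0 ≤ c n) {H k : ℕ} (hk : k < H) :
    ∑ h ∈ Finset.range H, c (Nat.dist h k) ≤ c 0 + 2 * ∑ d ∈ Finset.Ico 1 H, c d := by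
  have hsplit : ∑ h ∈ Finset.range H, c (Nat.dist h k)
      = ∑ h ∈ Finset.range k, c (Nat.dist h k) + c 0
        + ∑ h ∈ Finset.range (H - (k + 1)), c (Nat.dist (k + 1 + h) k) := by
    conv_lhs => rw [show H = (k + 1) + (H - (k + 1)) by omega, Finset.sum_range_add,
      Finset.sum_range_succ, Nat.dist_self]
  have h1 : ∑ h ∈ Finset.range k, c (Nat.dist h k) ≤ ∑ d ∈ Finset.Ico 1 H, c d := by
    rw [← Finset.sum_range_reflect]
    have : ∑ j ∈ Finset.range k, c (Nat.dist (k - 1 - j) k) = ∑ d ∈ Finset.Ico 1 (k + 1), c d := by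
      rw [Finset.sum_Ico_eq_sum_range]
      refine Finset.sum_congr (by simp) fun j hj => ?_
      rw [Finset.mem_range] at hj
      congr 1
      rw [Nat.dist_eq_sub_of_le (by omega)]; omega
    rw [this]
    exact Finset.sum_le_sum_of_subset_of_nonneg
      (Finset.Ico_subset_Ico le_rfl (by omega)) fun _ _ _ => hc _
  have h2 : ∑ h ∈ Finset.range (H - (k + 1)), c (Nat.dist (k + 1 + h) k)
      ≤ ∑ d ∈ Finset.Ico 1 H, c d := by
    have : ∑ h ∈ Finset.range (H - (k + 1)), c (Nat.dist (k + 1 + h) k)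
        = ∑ d ∈ Finset.Ico 1 (H - k), c d := by
      rw [Finset.sum_Ico_eq_sum_range]
      refine Finset.sum_congr (by congr 1) fun j _ => ?_
      congr 1
      rw [Nat.dist_comm, Nat.dist_eq_sub_of_le (by omega)]; omega
    rw [this]
    exact Finset.sum_le_sum_of_subset_of_nonneg
      (Finset.Ico_subset_Ico le_rfl (by omega)) fun _ _ _ => hc _
  rw [hsplit]; linarith

/-- Up to an error `2 * H`, the correlation of two shifts depends only on their distance. -/
lemma norm_correlation_le {u : ℕ → ℂ} (hu : ∀ n, ‖u n‖ ≤ 1) (N : ℕ) {H h k : ℕ}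
    (hh : h < H) (hk : k < H) :
    ‖∑ n ∈ Finset.range N, u (n + h) * conj (u (n + k))‖
      ≤ ‖∑ n ∈ Finset.range N, u (n + Nat.dist h k) * conj (u n)‖ + 2 * H := by
  wlog hkh : k ≤ h generalizing h k
  · have := this hk hh (by omega)
    rw [Nat.dist_comm, ← RCLike.norm_conj, map_sum]
    simpa [mul_comm] using this
  have hv : ∀ n, ‖u (n + (h - k)) * conj (u n)‖ ≤ 1 := fun n => by
    rw [norm_mul, RCLike.norm_conj]
    exact mul_le_one₀ (hu _) (norm_nonneg _) (hu _)
  have h1 := norm_sum_shift_sub_sum_le hv N k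
  rw [Nat.dist_comm, Nat.dist_eq_sub_of_le hkh]
  simp only [add_assoc, Nat.add_sub_cancel' hkh] at h1
  have h2 := norm_le_norm_add_norm_sub' (∑ n ∈ Finset.range N, u (n + h) * conj (u (n + k)))
    (∑ n ∈ Finset.range N, u (n + (h - k)) * conj (u n))
  have h3 : (k : ℝ) ≤ H := by exact_mod_cast hk.le
  linarith

/-- A weak form of van der Corput's inequality: the correlations
`∑ n < N, u (n + d) * conj (u n)` with `1 ≤ d < H` control the sum of `u` over `[0, N)`, up to
errors that are negligible for large `H` of smaller order than `N`. -/
lemma van_der_corput {u : ℕ → ℂ} (hu : ∀ n, ‖u n‖ ≤ 1) (N : ℕ) {H : ℕ} (hH : 0 < H) :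
    ‖∑ n ∈ Finset.range N, u n‖ ^ 2 ≤ 8 * (H : ℝ) ^ 2 + 2 * N ^ 2 / H + 4 * N * H
      + 4 * N / H * ∑ d ∈ Finset.Ico 1 H, ‖∑ n ∈ Finset.range N, u (n + d) * conj (u n)‖ := by
  set S := ∑ n ∈ Finset.range N, u n with hS
  set c : ℕ → ℝ := fun d => ‖∑ n ∈ Finset.range N, u (n + d) * conj (u n)‖ with hc
  set sc := ∑ d ∈ Finset.Ico 1 H, c d with hsc
  set T := ∑ n ∈ Finset.range N, ∑ h ∈ Finset.range H, u (n + h) with hT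
  have hH' : (0 : ℝ) < H := by exact_mod_cast hH
  -- each shift changes the sum by at most `2 * H`, so `T` is close to `H * S`
  have hTS : ‖(H : ℂ) * S‖ ≤ ‖T‖ + 2 * (H : ℝ) ^ 2 := by
    have h1 : ‖T - (H : ℂ) * S‖ ≤ 2 * (H : ℝ) ^ 2 := by
      have : T - (H : ℂ) * S = ∑ h ∈ Finset.range H,
          (∑ n ∈ Finset.range N, u (n + h) - ∑ n ∈ Finset.range N, u n) := by
        rw [hT, Finset.sum_comm, Finset.sum_sub_distrib]; simp [hS]
      rw [this]
      refine (norm_sum_le_of_le (n := fun _ => 2 * (H : ℝ)) _ fun h hh => ?_).trans ?_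
      · refine (norm_sum_shift_sub_sum_le hu N h).trans ?_
        have : (h : ℝ) ≤ H := by exact_mod_cast (Finset.mem_range.1 hh).le
        linarith
      · simp; nlinarith
    have := norm_le_norm_add_norm_sub' ((H : ℂ) * S) T
    rw [norm_sub_rev] at this
    linarith
  have hTsq : ‖T‖ ^ 2 ≤ N * ∑ n ∈ Finset.range N, ‖∑ h ∈ Finset.range H, u (n + h)‖ ^ 2 := by
    have h1 : ‖T‖ ≤ ∑ n ∈ Finset.range N, ‖∑ h ∈ Finset.range H, u (n + h)‖ := norm_sum_le _ _
    have h2 := sq_sum_le_card_mul_sum_sq (s := Finset.range N)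
      (f := fun n => ‖∑ h ∈ Finset.range H, u (n + h)‖)
    rw [Finset.card_range] at h2
    exact (pow_le_pow_left₀ (norm_nonneg _) h1 2).trans h2
  have hexp : ∑ n ∈ Finset.range N, ‖∑ h ∈ Finset.range H, u (n + h)‖ ^ 2
      ≤ ∑ k ∈ Finset.range H, ∑ h ∈ Finset.range H,
        ‖∑ n ∈ Finset.range N, u (n + h) * conj (u (n + k))‖ := by
    have h1 : ((∑ n ∈ Finset.range N, ‖∑ h ∈ Finset.range H, u (n + h)‖ ^ 2 : ℝ) : ℂ)
        = ∑ k ∈ Finset.range H, ∑ h ∈ Finset.range H,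
          ∑ n ∈ Finset.range N, u (n + h) * conj (u (n + k)) := by
      rw [Complex.ofReal_sum]
      have : ∀ n, ((‖∑ h ∈ Finset.range H, u (n + h)‖ ^ 2 : ℝ) : ℂ)
          = ∑ k ∈ Finset.range H, ∑ h ∈ Finset.range H, u (n + h) * conj (u (n + k)) := by
        intro n
        rw [Complex.ofReal_pow, ← Complex.mul_conj', map_sum, Finset.sum_mul_sum, Finset.sum_comm]
      simp only [this]
      rw [Finset.sum_comm]
      exact Finset.sum_congr rfl fun k _ => Finset.sum_comm
    have h2 : (∑ n ∈ Finset.range N, ‖∑ h ∈ Finset.range H, u (n + h)‖ ^ 2 : ℝ)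
        = ‖((∑ n ∈ Finset.range N, ‖∑ h ∈ Finset.range H, u (n + h)‖ ^ 2 : ℝ) : ℂ)‖ := by
      rw [Complex.norm_real, Real.norm_of_nonneg]
      positivity
    rw [h2, h1]
    exact (norm_sum_le _ _).trans (Finset.sum_le_sum fun k _ => norm_sum_le _ _)
  have hc0 : c 0 ≤ N := by
    have := norm_sum_le_card (v := fun n => u (n + 0) * conj (u n)) (fun n => by
      rw [norm_mul, RCLike.norm_conj]
      exact mul_le_one₀ (hu _) (norm_nonneg _) (hu _)) (Finset.range N)
    simpa [hc] using this
  have hbound : ∑ k ∈ Finset.range H, ∑ h ∈ Finset.range H,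
        ‖∑ n ∈ Finset.range N, u (n + h) * conj (u (n + k))‖ ≤ H * (N + 2 * sc + 2 * H ^ 2) := by
    have : ∀ k ∈ Finset.range H, ∑ h ∈ Finset.range H,
        ‖∑ n ∈ Finset.range N, u (n + h) * conj (u (n + k))‖ ≤ N + 2 * sc + 2 * (H : ℝ) ^ 2 := by
      intro k hk
      rw [Finset.mem_range] at hk
      calc _ ≤ ∑ h ∈ Finset.range H, (c (Nat.dist h k) + 2 * H) :=
            Finset.sum_le_sum fun h hh => norm_correlation_le hu N (Finset.mem_range.1 hh) hk
        _ = ∑ h ∈ Finset.range H, c (Nat.dist h k) + 2 * (H : ℝ) ^ 2 := by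
            rw [Finset.sum_add_distrib]; simp; ring
        _ ≤ _ := by
            have := sum_dist_le (c := c) (fun n => norm_nonneg _) hk
            linarith
    refine (Finset.sum_le_sum this).trans (le_of_eq ?_)
    simp only [Finset.sum_const, Finset.card_range, nsmul_eq_mul]
  have hfin : (H : ℝ) ^ 2 * ‖S‖ ^ 2
      ≤ 2 * (N * (H * (N + 2 * sc + 2 * H ^ 2))) + 8 * (H : ℝ) ^ 4 := by
    rw [norm_mul, Complex.norm_natCast] at hTS
    have h1 : (H * ‖S‖) ^ 2 ≤ (‖T‖ + 2 * (H : ℝ) ^ 2) ^ 2 :=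
      pow_le_pow_left₀ (by positivity) hTS 2
    have h2 := hTsq.trans (mul_le_mul_of_nonneg_left (hexp.trans hbound) (Nat.cast_nonneg N))
    nlinarith [sq_nonneg (‖T‖ - 2 * (H : ℝ) ^ 2)]
  have : ‖S‖ ^ 2 ≤ (2 * (N * (H * (N + 2 * sc + 2 * H ^ 2))) + 8 * (H : ℝ) ^ 4) / H ^ 2 := by
    rw [le_div_iff₀ (by positivity)]; linarith
  refine this.trans (le_of_eq ?_)
  field_simp
  ring

lemma HasMeanZero.tendsto {u : ℕ → ℂ} (h : HasMeanZero u) :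
    Tendsto (fun N : ℕ => ‖∑ n ∈ Finset.range N, u n‖ / N) atTop (nhds 0) := by
  have := (isLittleO_norm_left.2 h).tendsto_div_nhds_zero
  exact this

lemma hasMeanZero_of_tendsto_sq {u : ℕ → ℂ}
    (h : Tendsto (fun N : ℕ => ‖∑ n ∈ Finset.range N, u n‖ ^ 2 / (N : ℝ) ^ 2) atTop (nhds 0)) :
    HasMeanZero u := by
  have h1 : (fun N : ℕ => ‖∑ n ∈ Finset.range N, u n‖ ^ 2) =o[atTop]
      (fun N : ℕ => (N : ℝ) ^ 2) := by
    rw [isLittleO_iff_tendsto']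
    · exact h
    · filter_upwards [eventually_gt_atTop 0] with N hN h0
      have : (N : ℝ) ≠ 0 := by positivity
      exact absurd h0 (by positivity)
  exact isLittleO_norm_left.1 (h1.of_pow two_ne_zero)

/-- Van der Corput's difference theorem: correlations with mean zero for all shifts force mean
zero. -/
lemma hasMeanZero_of_correlations {u : ℕ → ℂ} (hu : ∀ n, ‖u n‖ ≤ 1)
    (h : ∀ d, 0 < d → HasMeanZero fun n => u (n + d) * conj (u n)) : HasMeanZero u := by
  apply hasMeanZero_of_tendsto_sq
  rw [Metric.tendsto_atTop]
  intro ε hε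
  obtain ⟨H, hH⟩ := exists_nat_gt (max 1 (4 / ε))
  have hH1 : (1 : ℝ) < H := (le_max_left _ _).trans_lt hH
  have hH2 : 4 / ε < H := (le_max_right _ _).trans_lt hH
  have hHpos : 0 < H := by exact_mod_cast (zero_lt_one.trans hH1)
  have hlim : Tendsto (fun N : ℕ => 8 * (H : ℝ) ^ 2 * ((N : ℝ)⁻¹) ^ 2 + 2 / H + 4 * H * (N : ℝ)⁻¹
      + 4 / H * ∑ d ∈ Finset.Ico 1 H,
        (‖∑ n ∈ Finset.range N, u (n + d) * conj (u n)‖ / N)) atTop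
      (nhds (8 * (H : ℝ) ^ 2 * 0 ^ 2 + 2 / H + 4 * H * 0 + 4 / H * ∑ d ∈ Finset.Ico 1 H, 0)) := by
    have h0 : Tendsto (fun N : ℕ => ((N : ℝ)⁻¹)) atTop (nhds 0) := tendsto_inv_atTop_nhds_zero_nat
    refine (((h0.pow 2).const_mul _).add tendsto_const_nhds |>.add (h0.const_mul _)).add
      (Tendsto.const_mul _ (tendsto_finsetSum _ fun d hd => ?_))
    exact (h d (Finset.mem_Ico.1 hd).1).tendsto
  have h2 : 8 * (H : ℝ) ^ 2 * 0 ^ 2 + 2 / H + 4 * H * 0 + 4 / H * ∑ d ∈ Finset.Ico 1 H, (0 : ℝ)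
      < ε := by
    simp only [Finset.sum_const_zero]
    rw [div_lt_iff₀ hε] at hH2
    have : 2 / (H : ℝ) < ε := by rw [div_lt_iff₀ (by linarith)]; linarith
    linarith
  obtain ⟨N₀, hN₀⟩ := eventually_atTop.1 (hlim.eventually_lt_const h2)
  refine ⟨max N₀ 1, fun N hN => ?_⟩
  have hNpos : (0 : ℝ) < N := by
    have : 1 ≤ N := (le_max_right _ _).trans hN
    exact_mod_cast this
  rw [Real.dist_eq, sub_zero, abs_of_nonneg (by positivity)]
  refine lt_of_le_of_lt ?_ (hN₀ N ((le_max_left _ _).trans hN))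
  rw [div_le_iff₀ (by positivity)]
  refine (van_der_corput hu N hHpos).trans (le_of_eq ?_)
  rw [← Finset.sum_div]
  field_simp

/-! ### Sequences with a controlled iterated difference -/

lemma fwdDiff_iterate_sum_shift (z : ℕ → ℝ) (h k : ℕ) :
    (Δ_[1])^[k] (fun n => ∑ i ∈ Finset.range h, z (n + i))
      = fun n => ∑ i ∈ Finset.range h, (Δ_[1])^[k] z (n + i) := by
  induction k generalizing z with
  | zero => rfl
  | succ k ih =>
    have : Δ_[1] (fun n => ∑ i ∈ Finset.range h, z (n + i))
        = fun n => ∑ i ∈ Finset.range h, Δ_[1] z (n + i) := by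
      funext n
      simp [fwdDiff, add_right_comm]
    rw [Function.iterate_succ_apply, this, ih, Function.iterate_succ_apply]

/-- Van der Corput's difference theorem lowers the order of an iterated difference: if a class
`Q` of sequences is stable under sums over windows, and a `k₀`-th difference in `Q` forces mean
zero, then so does a `k`-th difference in `Q` for every `k ≥ k₀`. -/
lemma hasMeanZero_of_iterate_fwdDiff {Q : (ℕ → ℝ) → Prop}
    (hQ : ∀ δ, Q δ → ∀ h, 0 < h → Q fun n => ∑ i ∈ Finset.range h, δ (n + i)) {k₀ : ℕ}
    (base : ∀ x, Q ((Δ_[1])^[k₀] x) → HasMeanZero fun n => ex (x n)) {k : ℕ} (hk : k₀ ≤ k) :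
    ∀ x, Q ((Δ_[1])^[k] x) → HasMeanZero fun n => ex (x n) := by
  induction k, hk using Nat.le_induction with
  | base => exact base
  | succ k _ ih =>
    intro x hx
    refine hasMeanZero_of_correlations (fun n => (norm_ex _).le) fun d hd => ?_
    simp only [← ex_sub]
    apply ih
    have : (fun n => x (n + d) - x n) = fun n => ∑ i ∈ Finset.range d, Δ_[1] x (n + i) := by
      funext n
      have := Finset.sum_range_sub (fun i => x (n + i)) d
      simpa [fwdDiff, add_assoc] using this.symm
    rw [this, fwdDiff_iterate_sum_shift]
    exact hQ _ hx d hd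

lemma HasMeanZero.const_mul {u : ℕ → ℂ} (h : HasMeanZero u) (c : ℂ) :
    HasMeanZero fun n => c * u n := by
  unfold HasMeanZero at *
  simp only [← Finset.mul_sum]
  exact h.const_mul_left c

lemma hasMeanZero_sum {ι : Type*} (s : Finset ι) {u : ι → ℕ → ℂ}
    (h : ∀ i ∈ s, HasMeanZero (u i)) : HasMeanZero fun n => ∑ i ∈ s, u i n := by
  unfold HasMeanZero at *
  simp only [Finset.sum_comm (t := s)]
  exact IsLittleO.fun_sum h

lemma isLittleO_const_natCast (c : ℂ) : (fun _ : ℕ => c) =o[atTop] fun N : ℕ => (N : ℝ) :=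
  isLittleO_const_left.2 (Or.inr (by
    simpa [Function.comp_def] using tendsto_natCast_atTop_atTop (R := ℝ)))

/-- If the differences of `x` tend to `β ∉ ℤ`, then the shift multiplies `ex (x n)` by nearly the
constant `ex β ≠ 1`, while it does not change the mean. -/
lemma hasMeanZero_of_tendsto_fwdDiff {x : ℕ → ℝ} {β : ℝ}
    (hx : Tendsto (Δ_[1] x) atTop (nhds β)) (hβ : ∀ z : ℤ, β ≠ z) :
    HasMeanZero fun n => ex (x n) := by
  have hne : ex β - 1 ≠ 0 := by
    intro h
    obtain ⟨z, hz⟩ := (ex_eq_one_iff β).1 (sub_eq_zero.1 h)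
    exact hβ z hz
  have h0 : Tendsto (fun n => ex (x n) * (ex β - ex (Δ_[1] x n))) atTop (nhds 0) := by
    have h1 : Tendsto (fun n => ex β - ex (Δ_[1] x n)) atTop (nhds 0) := by
      simpa using ((continuous_ex.tendsto β).comp hx).const_sub (ex β)
    rw [tendsto_zero_iff_norm_tendsto_zero] at h1 ⊢
    simpa [norm_ex] using h1
  have h1 := isLittleO_sum_range_of_tendsto_zero h0
  have h2 : (fun N : ℕ => ex (x N) - ex (x 0)) =o[atTop] fun N : ℕ => (N : ℝ) :=
    (IsBigO.of_bound 2 (Eventually.of_forall fun N => by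
      have := norm_sub_le (ex (x N)) (ex (x 0))
      rw [norm_ex, norm_ex] at this
      rw [norm_one]
      linarith)).trans_isLittleO (isLittleO_const_natCast 1)
  have h3 := (h1.add h2).const_mul_left (ex β - 1)⁻¹
  refine h3.congr_left fun N => ?_
  have h4 : ex (x N) - ex (x 0) = ∑ n ∈ Finset.range N, ex (x n) * (ex (Δ_[1] x n) - 1) := by
    rw [← Finset.sum_range_sub (fun n => ex (x n))]
    refine Finset.sum_congr rfl fun n _ => ?_
    rw [mul_sub, ← ex_add]; simp [fwdDiff]
  rw [h4, ← Finset.sum_add_distrib, inv_mul_eq_iff_eq_mul₀ hne, Finset.mul_sum]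
  exact Finset.sum_congr rfl fun n _ => by ring

lemma hasMeanZero_of_tendsto_iterate_fwdDiff {x : ℕ → ℝ} {β : ℝ} {k : ℕ} (hk : 1 ≤ k)
    (hx : Tendsto ((Δ_[1])^[k] x) atTop (nhds β)) (hβ : Irrational β) :
    HasMeanZero fun n => ex (x n) := by
  refine hasMeanZero_of_iterate_fwdDiff
    (Q := fun δ => ∃ β, Irrational β ∧ Tendsto δ atTop (nhds β)) ?_ ?_ hk x ⟨β, hβ, hx⟩
  · rintro δ ⟨β, hβ, hδ⟩ h hh
    refine ⟨h * β, hβ.natCast_mul hh.ne', ?_⟩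
    have := tendsto_finsetSum (Finset.range h) fun i _ => (tendsto_add_atTop_iff_nat i).2 hδ
    simpa using this
  · rintro x ⟨β, hβ, hx⟩
    exact hasMeanZero_of_tendsto_fwdDiff hx fun z => hβ.ne_int z

/-- Fejér's condition on a sequence `δ`: it decreases to zero, but more slowly than `1 / n`. -/
def IsFejer (δ : ℕ → ℝ) : Prop :=
  (∀ᶠ n in atTop, δ (n + 1) ≤ δ n) ∧ Tendsto δ atTop (nhds 0) ∧
    Tendsto (fun n : ℕ => n * δ n) atTop atTop

lemma IsFejer.eventually_pos {δ : ℕ → ℝ} (h : IsFejer δ) : ∀ᶠ n in atTop, 0 < δ n := by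
  filter_upwards [h.2.2.eventually_gt_atTop 0] with n hn
  exact pos_of_mul_pos_right hn (Nat.cast_nonneg n)

lemma eventually_add_of_eventually {p : ℕ → Prop} (h : ∀ᶠ n in atTop, p n) :
    ∀ᶠ n in atTop, ∀ i, p (n + i) := by
  obtain ⟨n₀, hn₀⟩ := eventually_atTop.1 h
  exact eventually_atTop.2 ⟨n₀, fun n hn i => hn₀ _ (by omega)⟩

lemma IsFejer.sum_shift {δ : ℕ → ℝ} (hδ : IsFejer δ) {h : ℕ} (hh : 0 < h) :
    IsFejer fun n => ∑ i ∈ Finset.range h, δ (n + i) := by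
  refine ⟨?_, ?_, ?_⟩
  · filter_upwards [eventually_add_of_eventually hδ.1] with n hn
    refine Finset.sum_le_sum fun i _ => ?_
    rw [add_right_comm]
    exact hn i
  · have := tendsto_finsetSum (Finset.range h) fun i _ => (tendsto_add_atTop_iff_nat i).2 hδ.2.1
    simpa using this
  · refine tendsto_atTop_mono' _ ?_ hδ.2.2
    filter_upwards [eventually_add_of_eventually hδ.eventually_pos] with n hn
    refine mul_le_mul_of_nonneg_left ?_ (Nat.cast_nonneg n)
    exact Finset.single_le_sum (f := fun i => δ (n + i)) (fun i _ => (hn i).le)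
      (Finset.mem_range.2 hh)

/-- The initial segment of an exponential sum is estimated trivially, and the rest by the
inequality of Kusmin and Landau. -/
lemma norm_sum_range_ex_le {y : ℕ → ℝ} {m M : ℕ} (hmM : m ≤ M)
    (hanti : ∀ n, m ≤ n → Δ_[1] y (n + 1) ≤ Δ_[1] y n)
    (hpos : 0 < Δ_[1] y M) (hhalf : Δ_[1] y m ≤ 1 / 2) :
    ‖∑ n ∈ Finset.range M, ex (y n)‖ ≤ m + 1 / Δ_[1] y M := by
  rw [← Finset.sum_range_add_sum_Ico _ hmM]
  refine (norm_add_le _ _).trans (add_le_add ?_ ?_)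
  · simpa using norm_sum_le_card (v := fun n => ex (y n)) (fun n => (norm_ex _).le)
      (Finset.range m)
  · exact norm_sum_ex_le_of_antitone hmM (fun n hn _ => hanti n hn) hpos hhalf

lemma hasMeanZero_of_isFejer_fwdDiff {x : ℕ → ℝ} (hx : IsFejer (Δ_[1] x)) :
    HasMeanZero fun n => ex (x n) := by
  obtain ⟨m, hm⟩ := eventually_atTop.1 (hx.1.and (hx.eventually_pos.and
    (hx.2.1.eventually_le_const (show (0 : ℝ) < 1 / 2 by norm_num))))
  have h1 : (fun N : ℕ => (m : ℝ) + 1 / Δ_[1] x N) =o[atTop] fun N : ℕ => (N : ℝ) := by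
    have ha : (fun _ : ℕ => (m : ℝ)) =o[atTop] fun N : ℕ => (N : ℝ) :=
      isLittleO_const_left.2 (Or.inr (by
        simpa [Function.comp_def] using tendsto_natCast_atTop_atTop (R := ℝ)))
    refine ha.add ?_
    rw [isLittleO_iff_tendsto']
    · refine (tendsto_inv_atTop_zero.comp hx.2.2).congr fun N => ?_
      simp [div_eq_mul_inv, mul_comm]
    · filter_upwards [eventually_gt_atTop 0] with N hN h0
      exact absurd h0 (by positivity)
  refine IsBigO.trans_isLittleO (IsBigO.of_bound 1 ?_) h1
  filter_upwards [eventually_ge_atTop m] with N hN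
  rw [one_mul]
  refine (norm_sum_range_ex_le hN (fun n hn => (hm n hn).1) (hm N hN).2.1
    (hm m le_rfl).2.2).trans (le_abs_self _)

lemma hasMeanZero_of_isFejer_iterate_fwdDiff {x : ℕ → ℝ} {k : ℕ} (hk : 1 ≤ k)
    (hx : IsFejer ((Δ_[1])^[k] x)) : HasMeanZero fun n => ex (x n) :=
  hasMeanZero_of_iterate_fwdDiff (fun _ hδ _ hh => hδ.sum_shift hh)
    (fun _ hx => hasMeanZero_of_isFejer_fwdDiff hx) hk x hx

/-- A sequence that decreases at a rate between `n ^ (-9/8)` and `n ^ (-3/4)`. The point of the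
exponents is that the first is smaller than `-1`, so that this range overlaps with the range of
Fejér's condition, and is still large enough for van der Corput's second derivative estimate. -/
def IsIntermediate (δ : ℕ → ℝ) : Prop :=
  ∃ c C : ℝ, 0 < c ∧ ∀ᶠ n : ℕ in atTop, δ (n + 1) ≤ δ n ∧ c * (n : ℝ) ^ (-(9 / 8) : ℝ) ≤ δ n ∧
    δ n ≤ C * (n : ℝ) ^ (-(3 / 4) : ℝ)

lemma sum_shift_le_mul {δ : ℕ → ℝ} {n : ℕ} (h : ∀ i, δ (n + i + 1) ≤ δ (n + i)) (d : ℕ) :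
    ∑ i ∈ Finset.range d, δ (n + i) ≤ d * δ n := by
  have h1 : ∀ i, δ (n + i) ≤ δ n := by
    intro i
    induction i with
    | zero => exact le_rfl
    | succ i ih => exact (h i).trans ih
  simpa using Finset.sum_le_sum (s := Finset.range d) fun i _ => h1 i

lemma IsIntermediate.sum_shift {δ : ℕ → ℝ} (hδ : IsIntermediate δ) {h : ℕ} (hh : 0 < h) :
    IsIntermediate fun n => ∑ i ∈ Finset.range h, δ (n + i) := by
  obtain ⟨c, C, hc, hδ⟩ := hδ
  -- the first term of the window gives the lower bound
  refine ⟨c, h * C, hc, ?_⟩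
  filter_upwards [eventually_add_of_eventually hδ, eventually_gt_atTop 0] with n hn hn0
  refine ⟨?_, ?_, ?_⟩
  · refine Finset.sum_le_sum fun i _ => ?_
    rw [add_right_comm]
    exact (hn i).1
  · refine (hn 0).2.1.trans (Finset.single_le_sum (f := fun i => δ (n + i)) (fun i _ => ?_)
      (Finset.mem_range.2 hh))
    exact le_trans (by positivity) (hn i).2.1
  · refine (sum_shift_le_mul (fun i => (hn i).1) h).trans ?_
    rw [mul_assoc]
    exact mul_le_mul_of_nonneg_left (hn 0).2.2 (Nat.cast_nonneg h)

/-- The correlation with shift `d` of an exponential sum whose second differences are of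
intermediate size: its phase has differences of size between `d * δ (2 * N)` and `d * δ m`. -/
lemma norm_correlation_ex_le {x : ℕ → ℝ} {m N d : ℕ} {l : ℝ} (hd : 0 < d) (hmN : m ≤ N)
    (hanti : ∀ n, m ≤ n → (Δ_[1])^[2] x (n + 1) ≤ (Δ_[1])^[2] x n)
    (hl : 0 < l) (hlow : ∀ i, i < d → l ≤ (Δ_[1])^[2] x (N + i))
    (hup : d * (Δ_[1])^[2] x m ≤ 1 / 2) :
    ‖∑ n ∈ Finset.range N, ex (x (n + d)) * conj (ex (x n))‖ ≤ m + 1 / l * (d : ℝ)⁻¹ := by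
  simp only [← ex_sub]
  have hy : (fun n => x (n + d) - x n) = fun n => ∑ i ∈ Finset.range d, Δ_[1] x (n + i) := by
    funext n
    have := Finset.sum_range_sub (fun i => x (n + i)) d
    simpa [fwdDiff, add_assoc] using this.symm
  have hΔ : Δ_[1] (fun n => x (n + d) - x n)
      = fun n => ∑ i ∈ Finset.range d, (Δ_[1])^[2] x (n + i) := by
    rw [hy]
    exact fwdDiff_iterate_sum_shift (Δ_[1] x) d 1
  have hd' : (0 : ℝ) < d := by exact_mod_cast hd
  have hN : d * l ≤ Δ_[1] (fun n => x (n + d) - x n) N := by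
    rw [hΔ]
    simpa using Finset.sum_le_sum (s := Finset.range d) fun i hi => hlow i (Finset.mem_range.1 hi)
  have hpos : 0 < d * l := by positivity
  refine (norm_sum_range_ex_le hmN (fun n hn => ?_) (hpos.trans_le hN) ?_).trans ?_
  · rw [hΔ]
    refine Finset.sum_le_sum fun i _ => ?_
    rw [add_right_comm]
    exact hanti _ (by omega)
  · rw [hΔ]
    exact (sum_shift_le_mul (fun i => hanti _ (by omega)) d).trans hup
  · have := one_div_le_one_div_of_le hpos hN
    have e : 1 / (d * l) = 1 / l * (d : ℝ)⁻¹ := by field_simp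
    linarith

/-- Van der Corput's inequality with `H` of size `N ^ (1/4)`, the first `m`, of size `N ^ (1/2)`,
terms of the correlations being estimated trivially. Here `q` stands for `N ^ (1/8)`. -/
lemma norm_sum_ex_sq_le {x : ℕ → ℝ} {c C q : ℝ} {N m H : ℕ} (hc : 0 < c) (hq : 1 ≤ q)
    (hqC : 4 * C ≤ q) (hN : (N : ℝ) = q ^ 8) (hH₁ : q ^ 2 / 2 ≤ H) (hH₂ : H ≤ q ^ 2)
    (hm₁ : q ^ 4 / 2 ≤ m) (hm₂ : m ≤ q ^ 4)
    (hδ : ∀ n : ℕ, m ≤ n → (Δ_[1])^[2] x (n + 1) ≤ (Δ_[1])^[2] x n ∧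
      c * (n : ℝ) ^ (-(9 / 8) : ℝ) ≤ (Δ_[1])^[2] x n ∧
      (Δ_[1])^[2] x n ≤ C * (n : ℝ) ^ (-(3 / 4) : ℝ)) :
    ‖∑ n ∈ Finset.range N, ex (x n)‖ ^ 2 ≤ N ^ 2 * ((20 + 32 / c * (1 + Real.log N)) / q) := by
  have hq0 : 0 < q := by linarith
  have hH0 : (0 : ℝ) < H := lt_of_lt_of_le (by positivity) hH₁
  have hHpos : 0 < H := by exact_mod_cast hH0
  have hm0 : (0 : ℝ) < m := lt_of_lt_of_le (by positivity) hm₁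
  have hN1 : (1 : ℝ) ≤ N := by rw [hN]; exact one_le_pow₀ hq
  have hmN : m ≤ N := by
    have : (m : ℝ) ≤ N := hm₂.trans (by rw [hN]; exact pow_le_pow_right₀ hq (by norm_num))
    exact_mod_cast this
  have hHN : H ≤ N := by
    have : (H : ℝ) ≤ N := hH₂.trans (by rw [hN]; exact pow_le_pow_right₀ hq (by norm_num))
    exact_mod_cast this
  have hC : 0 < C := by
    have h1 := (hδ m le_rfl).2
    have h2 : 0 < C * (m : ℝ) ^ (-(3 / 4) : ℝ) :=
      lt_of_lt_of_le (by positivity) (h1.1.trans h1.2)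
    exact pos_of_mul_pos_left h2 (by positivity)
  -- `n ≤ 2 * N = 2 * q ^ 8` gives `n ^ (9/8) ≤ 2 ^ (9/8) * q ^ 9 ≤ 4 * q ^ 9`
  have hlow : ∀ i, i < H → c / (4 * q ^ 9) ≤ (Δ_[1])^[2] x (N + i) := by
    intro i hi
    refine le_trans ?_ (hδ (N + i) (by omega)).2.1
    have h1 : ((N + i : ℕ) : ℝ) ≤ 2 * q ^ 8 := by
      rw [← hN]; push_cast
      have : (i : ℝ) ≤ N := by exact_mod_cast (hi.trans_le hHN).le
      linarith
    have h2 : (2 * q ^ 8) ^ (-(9 / 8) : ℝ) ≤ ((N + i : ℕ) : ℝ) ^ (-(9 / 8) : ℝ) :=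
      Real.rpow_le_rpow_of_nonpos (by push_cast; positivity) h1 (by norm_num)
    have h3 : (1 : ℝ) / (4 * q ^ 9) ≤ (2 * q ^ 8) ^ (-(9 / 8) : ℝ) := by
      rw [Real.rpow_neg (by positivity), ← one_div]
      refine one_div_le_one_div_of_le (by positivity) ?_
      rw [Real.mul_rpow (by positivity) (by positivity), ← Real.rpow_natCast q 8,
        ← Real.rpow_mul hq0.le]
      have h4 : (2 : ℝ) ^ (9 / 8 : ℝ) ≤ 4 := by
        have := Real.rpow_le_rpow_of_exponent_le (x := 2) (y := 9 / 8) (z := (2 : ℕ))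
          (by norm_num) (by norm_num)
        rw [Real.rpow_natCast] at this
        linarith
      have h5 : q ^ (((8 : ℕ) : ℝ) * (9 / 8)) = q ^ 9 := by
        rw [← Real.rpow_natCast q 9]; norm_num
      rw [h5]
      gcongr
    calc c / (4 * q ^ 9) = c * (1 / (4 * q ^ 9)) := by ring
      _ ≤ _ := by gcongr; exact h3.trans h2
  -- `d * δ m` is at most of order `q ^ 2 * (q ^ 4) ^ (-3/4) = 1 / q`
  have hup : ∀ d : ℕ, d ≤ H → d * (Δ_[1])^[2] x m ≤ 1 / 2 := by
    intro d hd
    have h1 : (m : ℝ) ^ (-(3 / 4) : ℝ) ≤ 2 / q ^ 3 := by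
      refine (Real.rpow_le_rpow_of_nonpos (by positivity) hm₁ (by norm_num)).trans ?_
      rw [Real.rpow_neg (by positivity), inv_le_comm₀ (by positivity) (by positivity), inv_div,
        Real.div_rpow (by positivity) (by positivity), ← Real.rpow_natCast q 4,
        ← Real.rpow_mul hq0.le]
      have h5 : q ^ (((4 : ℕ) : ℝ) * (3 / 4)) = q ^ 3 := by
        rw [← Real.rpow_natCast q 3]; norm_num
      have h4 : (2 : ℝ) ^ (3 / 4 : ℝ) ≤ 2 := by
        have := Real.rpow_le_rpow_of_exponent_le (x := 2) (y := 3 / 4) (z := 1)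
          (by norm_num) (by norm_num)
        rwa [Real.rpow_one] at this
      rw [h5]
      gcongr
    have h2 : (Δ_[1])^[2] x m ≤ C * (2 / q ^ 3) :=
      (hδ m le_rfl).2.2.trans (by gcongr)
    have h3 : (d : ℝ) ≤ q ^ 2 := (by exact_mod_cast hd : (d : ℝ) ≤ H).trans hH₂
    calc d * (Δ_[1])^[2] x m ≤ d * (C * (2 / q ^ 3)) := by gcongr
      _ ≤ q ^ 2 * (C * (2 / q ^ 3)) := by gcongr
      _ = 2 * C / q := by field_simp
      _ ≤ 1 / 2 := by rw [div_le_iff₀ hq0]; linarith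
  -- the logarithm comes from the harmonic sum over the shifts
  have hsum : ∑ d ∈ Finset.Ico 1 H,
      ‖∑ n ∈ Finset.range N, ex (x (n + d)) * conj (ex (x n))‖
      ≤ H * m + 4 * q ^ 9 / c * (1 + Real.log N) := by
    have h1 : ∀ d ∈ Finset.Ico 1 H, ‖∑ n ∈ Finset.range N, ex (x (n + d)) * conj (ex (x n))‖
        ≤ m + 4 * q ^ 9 / c * (d : ℝ)⁻¹ := by
      intro d hd
      rw [Finset.mem_Ico] at hd
      have := norm_correlation_ex_le (l := c / (4 * q ^ 9)) (by omega : 0 < d) hmN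
        (fun n hn => (hδ n hn).1) (by positivity) (fun i hi => hlow i (by omega)) (hup d hd.2.le)
      rwa [one_div_div] at this
    refine (Finset.sum_le_sum h1).trans ?_
    rw [Finset.sum_add_distrib, ← Finset.mul_sum]
    have h2 : ∑ d ∈ Finset.Ico 1 H, (m : ℝ) ≤ H * m := by
      rw [Finset.sum_const, Nat.card_Ico, nsmul_eq_mul]
      gcongr
      exact Nat.sub_le _ _
    have h3 : ∑ d ∈ Finset.Ico 1 H, (d : ℝ)⁻¹ ≤ 1 + Real.log N := by
      have h4 := harmonic_le_one_add_log N
      rw [harmonic_eq_sum_Icc] at h4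
      push_cast at h4
      refine le_trans (Finset.sum_le_sum_of_subset_of_nonneg ?_ fun _ _ _ => by positivity) h4
      intro d hd
      rw [Finset.mem_Ico] at hd
      rw [Finset.mem_Icc]
      omega
    gcongr
  refine (van_der_corput (fun n => (norm_ex (x n)).le) N hHpos).trans ?_
  have hlog : 0 ≤ Real.log N := Real.log_nonneg hN1
  have t1 : 8 * (H : ℝ) ^ 2 ≤ N ^ 2 * (8 / q) := by
    rw [hN]
    calc 8 * (H : ℝ) ^ 2 ≤ 8 * (q ^ 2) ^ 2 := by gcongr
      _ = 8 * q ^ 4 := by ring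
      _ ≤ 8 * q ^ 15 := by gcongr; norm_num
      _ = _ := by field_simp
  have t2 : 2 * (N : ℝ) ^ 2 / H ≤ N ^ 2 * (4 / q) := by
    calc 2 * (N : ℝ) ^ 2 / H ≤ 2 * (N : ℝ) ^ 2 / (q / 2) := by
          gcongr
          refine le_trans ?_ hH₁
          have : q ≤ q ^ 2 := by nlinarith
          linarith
      _ = _ := by field_simp; ring
  have t3 : 4 * (N : ℝ) * H ≤ N ^ 2 * (4 / q) := by
    rw [hN]
    calc 4 * q ^ 8 * H ≤ 4 * q ^ 8 * q ^ 2 := by gcongr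
      _ = 4 * q ^ 10 := by ring
      _ ≤ 4 * q ^ 15 := by gcongr; norm_num
      _ = _ := by field_simp
  have t4 : 4 * (N : ℝ) / H * (H * m + 4 * q ^ 9 / c * (1 + Real.log N))
      ≤ N ^ 2 * (4 / q) + N ^ 2 * (32 / c * (1 + Real.log N) / q) := by
    have a : 4 * (N : ℝ) / H * (H * m) ≤ N ^ 2 * (4 / q) := by
      rw [hN]
      calc 4 * q ^ 8 / H * (H * m) = 4 * q ^ 8 * m := by field_simp
        _ ≤ 4 * q ^ 8 * q ^ 4 := by gcongr
        _ = 4 * q ^ 12 := by ring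
        _ ≤ 4 * q ^ 15 := by gcongr; norm_num
        _ = _ := by field_simp
    have b : 4 * (N : ℝ) / H * (4 * q ^ 9 / c * (1 + Real.log N))
        ≤ N ^ 2 * (32 / c * (1 + Real.log N) / q) := by
      calc 4 * (N : ℝ) / H * (4 * q ^ 9 / c * (1 + Real.log N))
          ≤ 4 * (N : ℝ) / (q ^ 2 / 2) * (4 * q ^ 9 / c * (1 + Real.log N)) := by gcongr
        _ = N ^ 2 * (32 / c * (1 + Real.log N) / q) := by
          rw [sq (N : ℝ)]; nth_rw 3 [hN]; field_simp; ring
    rw [mul_add]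
    linarith
  have t5 := mul_le_mul_of_nonneg_left hsum (by positivity : 0 ≤ 4 * (N : ℝ) / H)
  have e : (N : ℝ) ^ 2 * ((20 + 32 / c * (1 + Real.log N)) / q)
      = N ^ 2 * (8 / q) + N ^ 2 * (4 / q) + N ^ 2 * (4 / q)
        + (N ^ 2 * (4 / q) + N ^ 2 * (32 / c * (1 + Real.log N) / q)) := by
    field_simp; ring
  rw [e]
  linarith

lemma hasMeanZero_of_isIntermediate_fwdDiff {x : ℕ → ℝ}
    (hx : IsIntermediate ((Δ_[1])^[2] x)) : HasMeanZero fun n => ex (x n) := by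
  obtain ⟨c, C, hc, hx⟩ := hx
  obtain ⟨n₀, hn₀⟩ := eventually_atTop.1 hx
  have hq : Tendsto (fun N : ℕ => (N : ℝ) ^ (1 / 8 : ℝ)) atTop atTop :=
    (tendsto_rpow_atTop (by norm_num)).comp tendsto_natCast_atTop_atTop
  have hlim : Tendsto (fun q : ℝ => (20 + 32 / c * (1 + 8 * Real.log q)) / q) atTop (nhds 0) := by
    have h1 : Tendsto (fun q : ℝ => Real.log q / q) atTop (nhds 0) :=
      Real.isLittleO_log_id_atTop.tendsto_div_nhds_zero
    have h2 : Tendsto (fun q : ℝ => (20 + 32 / c) * q⁻¹ + 32 / c * 8 * (Real.log q / q)) atTop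
        (nhds ((20 + 32 / c) * 0 + 32 / c * 8 * 0)) :=
      (tendsto_inv_atTop_zero.const_mul _).add (h1.const_mul _)
    rw [mul_zero, mul_zero, add_zero] at h2
    refine h2.congr fun q => ?_
    ring
  apply hasMeanZero_of_tendsto_sq
  refine tendsto_of_tendsto_of_tendsto_of_le_of_le' tendsto_const_nhds (hlim.comp hq)
    (Eventually.of_forall fun N => by positivity) ?_
  filter_upwards [hq.eventually_ge_atTop (max 2 (max (4 * C) (n₀ + 1))), eventually_gt_atTop 0]
    with N hN hN0
  simp only [max_le_iff] at hN
  obtain ⟨hq2, hqC, hqn⟩ := hN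
  set q := (N : ℝ) ^ (1 / 8 : ℝ) with hqdef
  have hNq : (N : ℝ) = q ^ 8 := by
    rw [hqdef, ← Real.rpow_natCast, ← Real.rpow_mul (Nat.cast_nonneg N)]; norm_num
  have hN0' : (0 : ℝ) < N := by exact_mod_cast hN0
  have hlog : Real.log N = 8 * Real.log q := by rw [hNq, Real.log_pow]; norm_num
  have hfl : ∀ y : ℝ, 2 ≤ y → y / 2 ≤ ⌊y⌋₊ := fun y hy => by
    linarith [Nat.lt_floor_add_one y]
  have hq4 : (4 : ℝ) ≤ q ^ 2 := by nlinarith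
  have hq44 : (4 : ℝ) ≤ q ^ 4 := by nlinarith
  have key := norm_sum_ex_sq_le (x := x) (m := ⌊q ^ 4⌋₊) (H := ⌊q ^ 2⌋₊) hc (by linarith) hqC hNq
    (hfl _ (by linarith)) (Nat.floor_le (by positivity)) (hfl _ (by linarith))
    (Nat.floor_le (by positivity)) (fun n hn => hn₀ n (le_trans ?_ hn))
  · rw [div_le_iff₀ (by positivity), Function.comp_apply, ← hlog]
    linarith
  · refine Nat.le_floor ?_
    have : q ≤ q ^ 4 := le_self_pow₀ (by linarith) (by norm_num)
    linarith

lemma hasMeanZero_of_isIntermediate_iterate_fwdDiff {x : ℕ → ℝ} {k : ℕ} (hk : 2 ≤ k)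
    (hx : IsIntermediate ((Δ_[1])^[k] x)) : HasMeanZero fun n => ex (x n) :=
  hasMeanZero_of_iterate_fwdDiff (fun _ hδ _ hh => hδ.sum_shift hh)
    (fun _ hx => hasMeanZero_of_isIntermediate_fwdDiff hx) hk x hx

/-! ### Periodic weights and Weyl's criterion -/

lemma ex_natCast_mul (r : ℕ) (s : ℝ) : ex (r * s) = ex s ^ r := by
  rw [ex, ex, ← Complex.exp_nat_mul]; congr 1; push_cast; ring

/-- Orthogonality of the characters of `ℤ / q`. -/
lemma sum_ex_div {q : ℕ} (hq : 0 < q) (n m : ℕ) :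
    ∑ r ∈ Finset.range q, ex (r * (((n : ℝ) - m) / q)) = if n ≡ m [MOD q] then (q : ℂ) else 0 := by
  have hq' : (q : ℝ) ≠ 0 := by positivity
  simp only [ex_natCast_mul]
  have hiff : ex (((n : ℝ) - m) / q) = 1 ↔ n ≡ m [MOD q] := by
    rw [ex_eq_one_iff, Nat.ModEq.comm, Nat.modEq_iff_dvd]
    constructor
    · rintro ⟨z, hz⟩
      rw [div_eq_iff hq'] at hz
      exact ⟨z, by rw [mul_comm]; exact_mod_cast hz⟩
    · rintro ⟨z, hz⟩
      refine ⟨z, ?_⟩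
      rw [div_eq_iff hq', mul_comm]
      exact_mod_cast hz
  split_ifs with h
  · rw [hiff.2 h]; simp
  · have h1 : ex (((n : ℝ) - m) / q) ≠ 1 := fun h' => h (hiff.1 h')
    have h2 : ex (((n : ℝ) - m) / q) ^ q = 1 := by
      rw [← ex_natCast_mul, mul_div_cancel₀ _ hq']
      exact_mod_cast ex_int ((n : ℤ) - m)
    rw [geom_sum_eq h1, h2]
    simp

/-- By Fourier analysis on `ℤ / q`, twists by rational frequencies control all periodic
weights. -/
lemma hasMeanZero_periodic_mul {u : ℕ → ℂ}
    (h : ∀ ρ : ℚ, HasMeanZero fun n : ℕ => ex (ρ * n) * u n) {w : ℕ → ℂ} {q : ℕ} (hq : 0 < q)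
    (hw : Function.Periodic w q) : HasMeanZero fun n => w n * u n := by
  have hq' : (q : ℂ) ≠ 0 := by exact_mod_cast hq.ne'
  have hfun : (fun n => w n * u n) = fun n : ℕ => ∑ m ∈ Finset.range q, ∑ r ∈ Finset.range q,
      (w m * (q : ℂ)⁻¹ * ex (-(r * m / q))) * (ex (((r / q : ℚ) : ℝ) * n) * u n) := by
    funext n
    have h1 : w n = ∑ m ∈ Finset.range q, w m * (q : ℂ)⁻¹ *
        (if n ≡ m [MOD q] then (q : ℂ) else 0) := by
      rw [Finset.sum_eq_single (n % q)]
      · rw [if_pos (Nat.mod_modEq n q).symm, hw.map_mod_nat, inv_mul_cancel_right₀ hq']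
      · intro m hm hne
        rw [if_neg, mul_zero]
        intro hmod
        exact hne (by rw [hmod, Nat.mod_eq_of_lt (Finset.mem_range.1 hm)])
      · intro hn
        exact absurd (Finset.mem_range.2 (Nat.mod_lt n hq)) hn
    conv_lhs => rw [h1]
    rw [Finset.sum_mul]
    refine Finset.sum_congr rfl fun m _ => ?_
    rw [← sum_ex_div hq, Finset.mul_sum, Finset.sum_mul]
    refine Finset.sum_congr rfl fun r _ => ?_
    have : ex (r * (((n : ℝ) - m) / q)) = ex (-(r * m / q)) * ex (((r / q : ℚ) : ℝ) * n) := by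
      rw [← ex_add]; congr 1; push_cast; ring
    rw [this]; ring
  rw [hfun]
  exact hasMeanZero_sum _ fun m _ => hasMeanZero_sum _ fun r _ => (h _).const_mul _

lemma fourier_coe_eq_ex (h : ℤ) (x : ℝ) :
    fourier h (x : UnitAddCircle) = ex (h * x) := by
  rw [fourier_coe_apply, ex]; congr 1; push_cast; ring

lemma integral_fourier_eq_zero {h : ℤ} (hh : h ≠ 0) :
    ∫ x, fourier h x ∂(AddCircle.haarAddCircle : MeasureTheory.Measure UnitAddCircle) = 0 :=
  MeasureTheory.integral_eq_zero_of_add_right_eq_neg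
    (fourier_add_half_inv_index hh (Fact.out : (0 : ℝ) < 1))

lemma average_Icc_eq {u : ℕ → ℂ} (N : ℕ) : (1 / (N : ℂ)) * ∑ n ∈ Finset.Icc 1 N, u n
    = (1 / (N : ℂ)) * ∑ n ∈ Finset.range N, u n + (1 / (N : ℂ)) * (u N - u 0) := by
  have h1 : ∑ n ∈ Finset.Icc 1 N, u n = ∑ n ∈ Finset.range N, u n + (u N - u 0) := by
    have := Finset.sum_range_succ u N
    rw [Finset.range_eq_Ico (a := N + 1), Finset.sum_eq_sum_Ico_succ_bot (by omega)] at this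
    have e : Finset.Icc 1 N = Finset.Ico (0 + 1) (N + 1) := rfl
    rw [e]
    linear_combination this
  rw [h1]; ring

lemma HasMeanZero.tendsto_average {u : ℕ → ℂ} (h : HasMeanZero u) (hu : ∀ n, ‖u n‖ ≤ 1) :
    Tendsto (fun N : ℕ => (1 / (N : ℂ)) * ∑ n ∈ Finset.Icc 1 N, u n) atTop (nhds 0) := by
  have h1 : (fun N : ℕ => ∑ n ∈ Finset.range N, u n + (u N - u 0))
      =o[atTop] fun N : ℕ => (N : ℝ) := by
    refine IsLittleO.add h (IsBigO.trans_isLittleO (IsBigO.of_bound 2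
      (Eventually.of_forall fun N => ?_)) (isLittleO_const_natCast 1))
    rw [norm_one]
    linarith [norm_sub_le (u N) (u 0), hu N, hu 0]
  have h2 := (isLittleO_norm_left.2 h1).tendsto_div_nhds_zero
  rw [tendsto_zero_iff_norm_tendsto_zero]
  refine h2.congr fun N => ?_
  rw [average_Icc_eq, ← mul_add, norm_mul, norm_div, norm_one, Complex.norm_natCast]
  ring

lemma norm_average_le (N : ℕ) {u : ℕ → ℂ} {C : ℝ} (hC : 0 ≤ C) (hu : ∀ n, ‖u n‖ ≤ C) :
    ‖(1 / (N : ℂ)) * ∑ n ∈ Finset.Icc 1 N, u n‖ ≤ C := by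
  rw [norm_mul, norm_div, norm_one, Complex.norm_natCast]
  have h1 : ‖∑ n ∈ Finset.Icc 1 N, u n‖ ≤ N * C := by
    simpa using norm_sum_le_of_le (Finset.Icc 1 N) (fun n _ => hu n)
  rcases Nat.eq_zero_or_pos N with rfl | hN
  · simpa using hC
  · have : (0 : ℝ) < N := by exact_mod_cast hN
    rw [one_div, inv_mul_le_iff₀ this]
    exact h1

/-- Weyl's criterion. -/
lemma isEquidistributed_of_hasMeanZero {x : ℕ → ℝ}
    (h : ∀ k : ℤ, k ≠ 0 → HasMeanZero fun n => ex (k * x n)) :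
    IsEquidistributed (fun n => (x n : UnitAddCircle))
      (AddCircle.haarAddCircle : MeasureTheory.Measure UnitAddCircle) := by
  set μ := (AddCircle.haarAddCircle : MeasureTheory.Measure UnitAddCircle)
  have hint : ∀ F : C(UnitAddCircle, ℂ), MeasureTheory.Integrable F μ := fun F =>
    F.continuous.integrable_of_hasCompactSupport (HasCompactSupport.of_compactSpace _)
  have hspan : ∀ G ∈ Submodule.span ℂ (Set.range (fourier (T := (1 : ℝ)))),
      Tendsto (fun N : ℕ => (1 / (N : ℂ)) * ∑ n ∈ Finset.Icc 1 N, G (x n)) atTop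
        (nhds (∫ t, G t ∂μ)) := by
    intro G hG
    induction hG using Submodule.span_induction with
    | mem G hG =>
      obtain ⟨k, rfl⟩ := hG
      rcases eq_or_ne k 0 with rfl | hk
      · have h1 : Tendsto (fun _ : ℕ => (1 : ℂ)) atTop
            (nhds (∫ t, (fourier 0 t : ℂ) ∂μ)) := by
          simp
        refine h1.congr' ?_
        filter_upwards [eventually_gt_atTop 0] with N hN
        have : (N : ℂ) ≠ 0 := by exact_mod_cast hN.ne'
        simp [this]
      · rw [integral_fourier_eq_zero hk]
        simp only [fourier_coe_eq_ex]
        exact (h k hk).tendsto_average fun n => (norm_ex _).le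
    | zero => simp
    | add F G _ _ hF hG =>
      have : ∫ t, (F + G) t ∂μ = ∫ t, F t ∂μ + ∫ t, G t ∂μ :=
        MeasureTheory.integral_add (hint F) (hint G)
      rw [this]
      refine (hF.add hG).congr fun N => ?_
      simp [Finset.sum_add_distrib, mul_add]
    | smul c G _ hG =>
      have : ∫ t, (c • G) t ∂μ = c * ∫ t, G t ∂μ := MeasureTheory.integral_const_mul c _
      rw [this]
      refine (hG.const_mul c).congr fun N => ?_
      simp only [ContinuousMap.smul_apply, smul_eq_mul, ← Finset.mul_sum]
      ring
  intro F
  rw [Metric.tendsto_atTop]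
  intro ε hε
  have hF : F ∈ closure (Submodule.span ℂ (Set.range (fourier (T := (1 : ℝ)))) :
      Set C(UnitAddCircle, ℂ)) := by
    rw [← Submodule.topologicalClosure_coe, span_fourier_closure_eq_top]
    trivial
  obtain ⟨G, hG, hFG⟩ := Metric.mem_closure_iff.1 hF (ε / 3) (by positivity)
  obtain ⟨N₀, hN₀⟩ := Metric.tendsto_atTop.1 (hspan G hG) (ε / 3) (by positivity)
  refine ⟨N₀, fun N hN => ?_⟩
  have hpt : ∀ t, ‖F t - G t‖ ≤ ε / 3 := fun t => by
    rw [← dist_eq_norm]; exact (ContinuousMap.dist_apply_le_dist t).trans hFG.le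
  have h1 : dist ((1 / (N : ℂ)) * ∑ n ∈ Finset.Icc 1 N, F (x n))
      ((1 / (N : ℂ)) * ∑ n ∈ Finset.Icc 1 N, G (x n)) ≤ ε / 3 := by
    rw [dist_eq_norm, ← mul_sub, ← Finset.sum_sub_distrib]
    exact norm_average_le N (by positivity) fun n => hpt _
  have h2 : dist (∫ t, G t ∂μ) (∫ t, F t ∂μ) ≤ ε / 3 := by
    rw [dist_comm, dist_eq_norm, ← MeasureTheory.integral_sub (hint F) (hint G)]
    simpa using MeasureTheory.norm_integral_le_of_norm_le_const
      (μ := μ) (Eventually.of_forall hpt)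
  have h3 := hN₀ N hN
  have h4 := dist_triangle4 ((1 / (N : ℂ)) * ∑ n ∈ Finset.Icc 1 N, F (x n))
    ((1 / (N : ℂ)) * ∑ n ∈ Finset.Icc 1 N, G (x n)) (∫ t, G t ∂μ) (∫ t, F t ∂μ)
  linarith

/-! ### Adjoining the identity function to a Hardy field -/

/-- The function is eventually zero, eventually positive or eventually negative. -/
def EventuallySigned (f : ℝ → ℝ) : Prop :=
  (∀ᶠ t in atTop, f t = 0) ∨ (∀ᶠ t in atTop, 0 < f t) ∨ ∀ᶠ t in atTop, f t < 0

lemma EventuallySigned.congr {f g : ℝ → ℝ} (hf : EventuallySigned f) (h : f =ᶠ[atTop] g) :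
    EventuallySigned g := by
  rcases hf with hf | hf | hf
  · exact Or.inl (by filter_upwards [hf, h] with t h1 h2; rwa [← h2])
  · exact Or.inr (Or.inl (by filter_upwards [hf, h] with t h1 h2; rwa [← h2]))
  · exact Or.inr (Or.inr (by filter_upwards [hf, h] with t h1 h2; rwa [← h2]))

lemma EventuallySigned.neg {f : ℝ → ℝ} (hf : EventuallySigned f) : EventuallySigned (-f) := by
  rcases hf with hf | hf | hf
  · exact Or.inl (by filter_upwards [hf] with t h1; simpa using h1)
  · exact Or.inr (Or.inr (by filter_upwards [hf] with t h1; simpa using h1))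
  · exact Or.inr (Or.inl (by filter_upwards [hf] with t h1; simpa using h1))

lemma EventuallySigned.mul {f g : ℝ → ℝ} (hf : EventuallySigned f) (hg : EventuallySigned g) :
    EventuallySigned (f * g) := by
  rcases hf with hf | hf | hf
  · exact Or.inl (by filter_upwards [hf] with t h1; simp [h1])
  · rcases hg with hg | hg | hg
    · exact Or.inl (by filter_upwards [hg] with t h1; simp [h1])
    · exact Or.inr (Or.inl (by filter_upwards [hf, hg] with t h1 h2; exact mul_pos h1 h2))
    · exact Or.inr (Or.inr (by
        filter_upwards [hf, hg] with t h1 h2; exact mul_neg_of_pos_of_neg h1 h2))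
  · rcases hg with hg | hg | hg
    · exact Or.inl (by filter_upwards [hg] with t h1; simp [h1])
    · exact Or.inr (Or.inr (by
        filter_upwards [hf, hg] with t h1 h2; exact mul_neg_of_neg_of_pos h1 h2))
    · exact Or.inr (Or.inl (by
        filter_upwards [hf, hg] with t h1 h2; exact mul_pos_of_neg_of_neg h1 h2))

lemma exists_forall_ge_of_eventually {p : ℝ → Prop} (h : ∀ᶠ t in atTop, p t) :
    ∃ T, ∀ t, T ≤ t → p t := eventually_atTop.1 h

lemma eventuallySigned_of_strictMonoOn {f : ℝ → ℝ} {T : ℝ}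
    (hf : StrictMonoOn f (Set.Ici T)) : EventuallySigned f := by
  by_cases h : ∃ t₀, T ≤ t₀ ∧ 0 ≤ f t₀
  · obtain ⟨t₀, h1, h2⟩ := h
    refine Or.inr (Or.inl ?_)
    filter_upwards [eventually_gt_atTop t₀] with t ht
    exact h2.trans_lt (hf h1 (h1.trans ht.le) ht)
  · push Not at h
    refine Or.inr (Or.inr ?_)
    filter_upwards [eventually_ge_atTop T] with t ht
    exact h t ht

lemma eventuallySigned_of_deriv_pos {f g : ℝ → ℝ} (h : ∀ᶠ t in atTop, HasDerivAt f (g t) t)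
    (hg : ∀ᶠ t in atTop, 0 < g t) : EventuallySigned f := by
  obtain ⟨T, hT⟩ := exists_forall_ge_of_eventually (h.and hg)
  refine eventuallySigned_of_strictMonoOn (T := T) (strictMonoOn_of_deriv_pos (convex_Ici T)
    (fun t ht => (hT t ht).1.continuousAt.continuousWithinAt) fun t ht => ?_)
  rw [interior_Ici] at ht
  rw [(hT t (le_of_lt ht)).1.deriv]
  exact (hT t (le_of_lt ht)).2

/-- A function whose derivative is eventually zero, positive or negative is eventually monotone,
and so has itself an eventual sign. -/
lemma EventuallySigned.of_hasDerivAt {f g : ℝ → ℝ} (h : ∀ᶠ t in atTop, HasDerivAt f (g t) t)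
    (hg : EventuallySigned g) : EventuallySigned f := by
  rcases hg with hg | hg | hg
  · obtain ⟨T, hT⟩ := exists_forall_ge_of_eventually (h.and hg)
    have hconst : ∀ t, T ≤ t → f t = f T := by
      intro t ht
      refine constant_of_has_deriv_right_zero (a := T) (b := t)
        (fun s hs => (hT s hs.1).1.continuousAt.continuousWithinAt) (fun s hs => ?_) t ⟨ht, le_rfl⟩
      have := (hT s hs.1).1
      rw [(hT s hs.1).2] at this
      exact this.hasDerivWithinAt
    have hev : (fun _ => f T) =ᶠ[atTop] f := by
      filter_upwards [eventually_ge_atTop T] with t ht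
      exact (hconst t ht).symm
    refine EventuallySigned.congr ?_ hev
    rcases lt_trichotomy (f T) 0 with h0 | h0 | h0
    · exact Or.inr (Or.inr (Eventually.of_forall fun _ => h0))
    · exact Or.inl (Eventually.of_forall fun _ => h0)
    · exact Or.inr (Or.inl (Eventually.of_forall fun _ => h0))
  · exact eventuallySigned_of_deriv_pos h hg
  · have h1 : EventuallySigned (-f) :=
      eventuallySigned_of_deriv_pos (g := -g) (by filter_upwards [h] with t ht using ht.neg)
        (by filter_upwards [hg] with t ht; simpa using ht)
    simpa using h1.neg

lemma eventuallySigned_of_ne_zero {f : ℝ → ℝ} (hd : ∀ᶠ t in atTop, ContinuousAt f t)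
    (h : ∀ᶠ t in atTop, f t ≠ 0) : EventuallySigned f := by
  obtain ⟨T, hT⟩ := exists_forall_ge_of_eventually (hd.and h)
  have hcont : ContinuousOn f (Set.Ici T) := fun t ht => (hT t ht).1.continuousWithinAt
  by_cases hpos : ∃ s, T ≤ s ∧ 0 < f s
  · obtain ⟨s, hs, hfs⟩ := hpos
    refine Or.inr (Or.inl ?_)
    filter_upwards [eventually_ge_atTop T] with t ht
    by_contra hneg
    obtain ⟨r, hr, hr0⟩ := isPreconnected_Ici.intermediate_value ht hs hcont
      ⟨not_lt.1 hneg, hfs.le⟩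
    exact (hT r hr).2 hr0
  · push Not at hpos
    refine Or.inr (Or.inr ?_)
    filter_upwards [eventually_ge_atTop T] with t ht
    exact lt_of_le_of_ne (hpos t ht) (hT t ht).2

/-- A ring of functions that have an eventual sign, closed under differentiation and containing
the identity and the rational constants. Germs play no role once such a ring is at hand. -/
structure IsHardyRing (S : Subring (ℝ → ℝ)) : Prop where
  signed : ∀ f ∈ S, EventuallySigned f
  differentiable : ∀ f ∈ S, ∀ᶠ t in atTop, DifferentiableAt ℝ f t
  deriv_mem : ∀ f ∈ S, deriv f ∈ S
  id_mem : (fun t : ℝ => t) ∈ S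
  const_mem : ∀ c : ℚ, (fun _ : ℝ => (c : ℝ)) ∈ S

/-- The germ `y` is the derivative of the germ `x`. -/
def IsGermDeriv (x y : Germ (atTop : Filter ℝ) ℝ) : Prop :=
  ∃ f g : ℝ → ℝ, (f : Germ (atTop : Filter ℝ) ℝ) = x ∧ (g : Germ (atTop : Filter ℝ) ℝ) = y ∧
    ∀ᶠ t in atTop, HasDerivAt f (g t) t

lemma IsGermDeriv.add {x y x' y' : Germ (atTop : Filter ℝ) ℝ} (h : IsGermDeriv x x')
    (h' : IsGermDeriv y y') : IsGermDeriv (x + y) (x' + y') := by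
  obtain ⟨f, g, rfl, rfl, hfg⟩ := h
  obtain ⟨f', g', rfl, rfl, hfg'⟩ := h'
  exact ⟨f + f', g + g', rfl, rfl, by filter_upwards [hfg, hfg'] with t h1 h2 using h1.add h2⟩

lemma IsGermDeriv.mul {x y x' y' : Germ (atTop : Filter ℝ) ℝ} (h : IsGermDeriv x x')
    (h' : IsGermDeriv y y') : IsGermDeriv (x * y) (x' * y + x * y') := by
  obtain ⟨f, g, rfl, rfl, hfg⟩ := h
  obtain ⟨f', g', rfl, rfl, hfg'⟩ := h'
  exact ⟨f * f', g * f' + f * g', rfl, rfl,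
    by filter_upwards [hfg, hfg'] with t h1 h2 using h1.mul h2⟩

lemma isGermDeriv_zero : IsGermDeriv 0 0 :=
  ⟨0, 0, rfl, rfl, Eventually.of_forall fun t => hasDerivAt_const t 0⟩

/-- The germ of the identity function. -/
def idGerm : Germ (atTop : Filter ℝ) ℝ := ((fun t : ℝ => t : ℝ → ℝ) : Germ (atTop : Filter ℝ) ℝ)

lemma isGermDeriv_id_pow (i : ℕ) : IsGermDeriv (idGerm ^ i) (i * idGerm ^ (i - 1)) :=
  ⟨fun t => t ^ i, fun t => i * t ^ (i - 1), rfl, rfl,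
    Eventually.of_forall fun t => hasDerivAt_pow i t⟩

lemma IsGermDeriv.sum {ι : Type*} (s : Finset ι) {x y : ι → Germ (atTop : Filter ℝ) ℝ}
    (h : ∀ i ∈ s, IsGermDeriv (x i) (y i)) : IsGermDeriv (∑ i ∈ s, x i) (∑ i ∈ s, y i) := by
  classical
  induction s using Finset.induction_on with
  | empty => simpa using isGermDeriv_zero
  | insert i s hi ih =>
    rw [Finset.sum_insert hi, Finset.sum_insert hi]
    exact (h i (Finset.mem_insert_self i s)).add
      (ih fun j hj => h j (Finset.mem_insert_of_mem hj))

lemma IsGermDeriv.eventually_hasDerivAt {x y : Germ (atTop : Filter ℝ) ℝ} (h : IsGermDeriv x y)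
    {f g : ℝ → ℝ} (hf : (f : Germ (atTop : Filter ℝ) ℝ) = x)
    (hg : (g : Germ (atTop : Filter ℝ) ℝ) = y) : ∀ᶠ t in atTop, HasDerivAt f (g t) t := by
  obtain ⟨f₁, g₁, rfl, rfl, h⟩ := h
  obtain ⟨T, hT⟩ := exists_forall_ge_of_eventually (Germ.coe_eq.1 hf)
  filter_upwards [h, Germ.coe_eq.1 hg, eventually_gt_atTop T] with t h1 h2 h3
  rw [h2]
  exact h1.congr_of_eventuallyEq (by
    filter_upwards [Ioi_mem_nhds h3] with s hs using hT s (le_of_lt hs))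

section

open Polynomial

variable {K : Subring (Germ (atTop : Filter ℝ) ℝ)}

lemma exists_isGermDeriv_of_mem (hK : IsHardyField K) (c : K) :
    ∃ c' : K, IsGermDeriv c c' := by
  obtain ⟨c, hc⟩ := c
  induction c using Germ.inductionOn with
  | _ f =>
    have := hK.deriv_mem f hc
    exact ⟨⟨_, this.2⟩, f, deriv f, rfl, rfl,
      by filter_upwards [this.1] with t ht using ht.hasDerivAt⟩

/-- A nonzero element of a Hardy field is invertible, so it has no zeros near infinity, and it is
continuous there. -/
lemma eventuallySigned_of_mem (hK : IsHardyField K) {f : ℝ → ℝ}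
    (hf : (f : Germ (atTop : Filter ℝ) ℝ) ∈ K) : EventuallySigned f := by
  by_cases h0 : (⟨_, hf⟩ : K) = 0
  · have h1 : (f : Germ (atTop : Filter ℝ) ℝ) = ((0 : ℝ → ℝ) : Germ (atTop : Filter ℝ) ℝ) :=
      congrArg Subtype.val h0
    exact Or.inl (Germ.coe_eq.1 h1)
  · obtain ⟨⟨d, hd⟩, hd1⟩ := hK.isField.mul_inv_cancel h0
    induction d using Germ.inductionOn with
    | _ g =>
      have h1 : ((f * g : ℝ → ℝ) : Germ (atTop : Filter ℝ) ℝ)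
          = ((1 : ℝ → ℝ) : Germ (atTop : Filter ℝ) ℝ) := congrArg Subtype.val hd1
      refine eventuallySigned_of_ne_zero ?_ ?_
      · filter_upwards [(hK.deriv_mem f hf).1] with t ht using ht.continuousAt
      · filter_upwards [Germ.coe_eq.1 h1] with t ht h
        simp [h] at ht

lemma aeval_idGerm_eq_sum {P : K[X]} {n : ℕ} (hP : P.degree < n) :
    aeval idGerm P
      = ∑ i ∈ Finset.range n, (P.coeff i : Germ (atTop : Filter ℝ) ℝ) * idGerm ^ i := by
  rcases eq_or_ne P 0 with rfl | hP0
  · rw [map_zero]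
    refine (Finset.sum_eq_zero fun i _ => ?_).symm
    rw [coeff_zero]
    exact zero_mul _
  · have := (natDegree_lt_iff_degree_lt hP0).2 hP
    rw [aeval_eq_sum_range' this]
    rfl

/-- The derivative of a polynomial in the identity is such a polynomial of at most the same degree;
the bound `n` on the degree is kept fixed. -/
lemma exists_isGermDeriv_aeval (hK : IsHardyField K) {P : K[X]} {n : ℕ} (hP : P.degree < n) :
    ∃ P' : K[X], P'.degree < n ∧ IsGermDeriv (aeval idGerm P) (aeval idGerm P') := by
  choose δ hδ using exists_isGermDeriv_of_mem hK
  refine ⟨∑ i ∈ Finset.range n, (C (δ (P.coeff i)) * X ^ i + C (P.coeff i * i) * X ^ (i - 1)),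
    ?_, ?_⟩
  · rw [← mem_degreeLT]
    refine Submodule.sum_mem _ fun i hi => Submodule.add_mem _ ?_ ?_
    all_goals
      rw [Finset.mem_range] at hi
      rw [mem_degreeLT]
      refine (degree_C_mul_X_pow_le _ _).trans_lt ?_
      exact_mod_cast (by omega)
  · rw [aeval_idGerm_eq_sum hP, map_sum]
    refine IsGermDeriv.sum _ fun i _ => ?_
    have := (hδ (P.coeff i)).mul (isGermDeriv_id_pow i)
    convert this using 1
    simp only [map_add, map_mul, aeval_C, map_pow, aeval_X]
    have e : (algebraMap K (Germ (atTop : Filter ℝ) ℝ)) (i : K) = i := map_natCast _ i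
    rw [e, mul_assoc]
    rfl

/-- Every polynomial in the identity over a Hardy field has an eventual sign: after division by
the leading coefficient, the derivative is a polynomial of lower degree. -/
lemma eventuallySigned_aeval (hK : IsHardyField K) (n : ℕ) :
    ∀ P : K[X], P.degree < n → ∀ f : ℝ → ℝ,
      (f : Germ (atTop : Filter ℝ) ℝ) = aeval idGerm P → EventuallySigned f := by
  induction n with
  | zero =>
    intro P hP f hf
    have : P = 0 := degree_eq_bot.1 (by simpa using hP)
    rw [this, map_zero] at hf
    exact Or.inl (Germ.coe_eq.1 (hf.trans Germ.coe_zero.symm))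
  | succ n ih =>
    intro P hP f hf
    have hPle : P.degree ≤ n := Order.lt_succ_iff.1 (by exact_mod_cast hP)
    by_cases hc : P.coeff n = 0
    · refine ih P (lt_of_le_of_ne hPle fun h => ?_) f hf
      exact coeff_ne_zero_of_eq_degree h hc
    · obtain ⟨d, hd⟩ := hK.isField.mul_inv_cancel hc
      set Q : K[X] := C d * P - X ^ n with hQ
      have hQdeg : Q.degree < n := by
        refine lt_of_le_of_ne ?_ fun h => coeff_ne_zero_of_eq_degree h ?_
        · refine (degree_sub_le _ _).trans (max_le ?_ ?_)
          · have h := (degree_smul_le d P).trans hPle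
            rwa [smul_eq_C_mul] at h
          · exact degree_X_pow_le n
        · rw [hQ, coeff_sub, coeff_C_mul, coeff_X_pow, if_pos rfl, mul_comm, hd, sub_self]
      obtain ⟨Q', hQ', hder⟩ := exists_isGermDeriv_aeval hK hQdeg
      set M' : K[X] := Q' + C (n : K) * X ^ (n - 1) with hM'
      have hM'deg : M'.degree < n := by
        refine (degree_add_le _ _).trans_lt (max_lt hQ' ?_)
        rcases Nat.eq_zero_or_pos n with rfl | hn
        · simp
        · exact (degree_C_mul_X_pow_le _ _).trans_lt (by exact_mod_cast (by omega))
      have hM : IsGermDeriv (aeval idGerm (C d * P)) (aeval idGerm M') := by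
        have h1 := hder.add (isGermDeriv_id_pow n)
        have e1 : aeval idGerm (C d * P) = aeval idGerm Q + idGerm ^ n := by
          rw [hQ, map_sub, map_pow, aeval_X, sub_add_cancel]
        have e2 : aeval idGerm M' = aeval idGerm Q' + n * idGerm ^ (n - 1) := by
          have e : (algebraMap K (Germ (atTop : Filter ℝ) ℝ)) (n : K) = n := map_natCast _ n
          rw [hM', map_add, map_mul, aeval_C, map_pow, aeval_X, e]
        rw [e1, e2]
        exact h1
      obtain ⟨F, hF⟩ : ∃ F : ℝ → ℝ, (F : Germ (atTop : Filter ℝ) ℝ) = aeval idGerm (C d * P) :=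
        Quotient.exists_rep _
      obtain ⟨G, hG⟩ : ∃ G : ℝ → ℝ, (G : Germ (atTop : Filter ℝ) ℝ) = aeval idGerm M' :=
        Quotient.exists_rep _
      obtain ⟨c, hcc⟩ : ∃ c : ℝ → ℝ, (c : Germ (atTop : Filter ℝ) ℝ) = P.coeff n :=
        Quotient.exists_rep _
      have hFs : EventuallySigned F :=
        EventuallySigned.of_hasDerivAt (hM.eventually_hasDerivAt hF hG) (ih M' hM'deg G hG)
      have hcs : EventuallySigned c := eventuallySigned_of_mem hK (by rw [hcc]; exact (P.coeff n).2)
      refine (hcs.mul hFs).congr (Germ.coe_eq.1 ?_)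
      rw [Germ.coe_mul, hcc, hF, hf, map_mul, aeval_C, ← mul_assoc]
      have : (P.coeff n : Germ (atTop : Filter ℝ) ℝ) * algebraMap K _ d = 1 :=
        congrArg Subtype.val hd
      rw [this, one_mul]

/-- The functions whose germs are polynomials in the identity over a Hardy field form a ring of
eventually signed functions. -/
lemma exists_isHardyRing {a : ℝ → ℝ} (ha : IsHardyFunction a) :
    ∃ S : Subring (ℝ → ℝ), IsHardyRing S ∧ a ∈ S := by
  obtain ⟨K, hK, haK⟩ := ha
  set A : Subalgebra K (Germ (atTop : Filter ℝ) ℝ) := Algebra.adjoin K {idGerm} with hA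
  have hmemA : ∀ x, x ∈ A ↔ ∃ P : K[X], aeval idGerm P = x := by
    intro x
    rw [hA, Algebra.adjoin_singleton_eq_range_aeval]
    rfl
  have hKA : ∀ x ∈ K, x ∈ A := fun x hx => A.algebraMap_mem ⟨x, hx⟩
  set S : Subring (ℝ → ℝ) := A.toSubring.comap (Germ.coeRingHom (atTop : Filter ℝ)) with hS
  have hmem : ∀ f : ℝ → ℝ, f ∈ S ↔ (f : Germ (atTop : Filter ℝ) ℝ) ∈ A := fun f => Iff.rfl
  have hder : ∀ f ∈ S, ∃ g ∈ S, ∀ᶠ t in atTop, HasDerivAt f (g t) t := by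
    intro f hf
    obtain ⟨P, hP⟩ := (hmemA _).1 ((hmem f).1 hf)
    obtain ⟨P', -, hP'⟩ := exists_isGermDeriv_aeval hK (P := P) (n := P.natDegree + 1)
      (degree_le_natDegree.trans_lt (by exact_mod_cast Nat.lt_succ_self _))
    obtain ⟨g, hg⟩ : ∃ g : ℝ → ℝ, (g : Germ (atTop : Filter ℝ) ℝ) = aeval idGerm P' :=
      Quotient.exists_rep _
    exact ⟨g, (hmem g).2 ((hmemA _).2 ⟨P', hg.symm⟩), hP'.eventually_hasDerivAt hP.symm hg⟩
  refine ⟨S, ⟨fun f hf => ?_, fun f hf => ?_, fun f hf => ?_, ?_, fun c => ?_⟩, ?_⟩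
  · obtain ⟨P, hP⟩ := (hmemA _).1 ((hmem f).1 hf)
    exact eventuallySigned_aeval hK (P.natDegree + 1) P
      (degree_le_natDegree.trans_lt (by exact_mod_cast Nat.lt_succ_self _)) f hP.symm
  · obtain ⟨g, -, hg⟩ := hder f hf
    filter_upwards [hg] with t ht using ht.differentiableAt
  · obtain ⟨g, hgS, hg⟩ := hder f hf
    rw [hmem] at hgS ⊢
    have : (deriv f : Germ (atTop : Filter ℝ) ℝ) = (g : Germ (atTop : Filter ℝ) ℝ) :=
      Germ.coe_eq.2 (by filter_upwards [hg] with t ht using ht.deriv)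
    rwa [this]
  · exact (hmem _).2 (Algebra.self_mem_adjoin_singleton K idGerm)
  · refine (hmem _).2 (hKA _ ?_)
    have hden : ((c.den : ℕ) : K) ≠ 0 := by
      intro h
      have h1 : (((c.den : ℕ) : ℝ → ℝ) : Germ (atTop : Filter ℝ) ℝ)
          = ((0 : ℝ → ℝ) : Germ (atTop : Filter ℝ) ℝ) := congrArg Subtype.val h
      obtain ⟨t, ht⟩ := (Germ.coe_eq.1 h1).exists
      simp at ht
    obtain ⟨d, hd⟩ := hK.isField.mul_inv_cancel hden
    have h2 : ((fun _ => (c : ℝ) : ℝ → ℝ) : Germ (atTop : Filter ℝ) ℝ)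
        = (((c.num : ℤ) : K) * d : K) := by
      have h3 : ((fun _ => (c : ℝ) : ℝ → ℝ) : Germ (atTop : Filter ℝ) ℝ)
          * (((c.den : ℕ) : K) : Germ (atTop : Filter ℝ) ℝ)
          = (((c.num : ℤ) : K) : Germ (atTop : Filter ℝ) ℝ) := by
        refine Germ.coe_eq.2 (Eventually.of_forall fun t => ?_)
        have : (c : ℝ) * c.den = c.num := by exact_mod_cast Rat.mul_den_eq_num c
        exact this
      have h4 : (((c.den : ℕ) : K) : Germ (atTop : Filter ℝ) ℝ) * (d : Germ (atTop : Filter ℝ) ℝ)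
          = 1 := congrArg Subtype.val hd
      rw [Subring.coe_mul, ← h3, mul_assoc, h4, mul_one]
    rw [h2]
    exact SetLike.coe_mem _
  · exact (hmem _).2 (hKA _ haK)

end

/-! ### Limits and growth in a Hardy ring -/

lemma exists_eventually_le_add_of_deriv_le {f g f' g' : ℝ → ℝ}
    (hf : ∀ᶠ t in atTop, HasDerivAt f (f' t) t) (hg : ∀ᶠ t in atTop, HasDerivAt g (g' t) t)
    (h : ∀ᶠ t in atTop, f' t ≤ g' t) : ∃ B, ∀ᶠ t in atTop, f t ≤ g t + B := by
  obtain ⟨T, hT⟩ := exists_forall_ge_of_eventually (hf.and (hg.and h))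
  refine ⟨f T - g T, ?_⟩
  have hmono : MonotoneOn (g - f) (Set.Ici T) := by
    refine monotoneOn_of_deriv_nonneg (convex_Ici T)
      (fun t ht => ((hT t ht).2.1.sub (hT t ht).1).continuousAt.continuousWithinAt)
      (fun t ht => ?_) fun t ht => ?_
    · rw [interior_Ici] at ht
      exact ((hT t (le_of_lt ht)).2.1.sub
        (hT t (le_of_lt ht)).1).differentiableAt.differentiableWithinAt
    · rw [interior_Ici] at ht
      rw [((hT t (le_of_lt ht)).2.1.sub (hT t (le_of_lt ht)).1).deriv]
      linarith [(hT t (le_of_lt ht)).2.2]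
  filter_upwards [eventually_ge_atTop T] with t ht
  have := hmono (Set.mem_Ici.2 le_rfl) ht ht
  simp only [Pi.sub_apply] at this
  linarith

lemma iterate_deriv_neg (f : ℝ → ℝ) (k : ℕ) : deriv^[k] (-f) = -deriv^[k] f := by
  induction k generalizing f with
  | zero => rfl
  | succ k ih =>
    have : deriv (-f) = -deriv f := by funext t; exact deriv.neg
    rw [Function.iterate_succ_apply, this, ih, Function.iterate_succ_apply]

namespace IsHardyRing

variable {S : Subring (ℝ → ℝ)} (hS : IsHardyRing S) {f g : ℝ → ℝ}

include hS

lemma eventually_hasDerivAt (hf : f ∈ S) : ∀ᶠ t in atTop, HasDerivAt f (deriv f t) t := by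
  filter_upwards [hS.differentiable f hf] with t ht using ht.hasDerivAt

lemma iterate_deriv_mem (hf : f ∈ S) (k : ℕ) : deriv^[k] f ∈ S := by
  induction k with
  | zero => exact hf
  | succ k ih => rw [Function.iterate_succ_apply']; exact hS.deriv_mem _ ih

lemma eventually_le_or_le (hf : f ∈ S) (hg : g ∈ S) :
    (∀ᶠ t in atTop, f t ≤ g t) ∨ ∀ᶠ t in atTop, g t ≤ f t := by
  rcases hS.signed _ (S.sub_mem hf hg) with h | h | h
  · exact Or.inl (by filter_upwards [h] with t ht; exact (sub_eq_zero.1 ht).le)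
  · exact Or.inr (by filter_upwards [h] with t ht; exact (sub_pos.1 ht).le)
  · exact Or.inl (by filter_upwards [h] with t ht; exact (sub_neg.1 ht).le)

lemma natCast_mem (n : ℕ) : (fun _ : ℝ => (n : ℝ)) ∈ S := by
  simpa using hS.const_mem n

lemma eventually_le_const_or_tendsto_atTop (hf : f ∈ S) :
    (∃ n : ℕ, ∀ᶠ t in atTop, f t ≤ n) ∨ Tendsto f atTop atTop := by
  by_cases h : ∃ n : ℕ, ∀ᶠ t in atTop, f t ≤ n
  · exact Or.inl h
  · refine Or.inr (tendsto_atTop.2 fun b => ?_)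
    obtain ⟨n, hn⟩ := exists_nat_ge b
    filter_upwards [(hS.eventually_le_or_le hf (hS.natCast_mem n)).resolve_left
      (not_exists.1 h n)] with t ht
    exact hn.trans ht

lemma exists_tendsto_of_bounded (hf : f ∈ S) {A B : ℝ} (hA : ∀ᶠ t in atTop, A ≤ f t)
    (hB : ∀ᶠ t in atTop, f t ≤ B) : ∃ c, Tendsto f atTop (nhds c) := by
  refine tendsto_of_no_upcrossings (s := Set.range ((↑) : ℚ → ℝ)) Rat.denseRange_cast ?_
    ⟨B, hB⟩ ⟨A, hA⟩
  rintro _ ⟨a, rfl⟩ b - hab ⟨h1, h2⟩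
  rcases hS.eventually_le_or_le hf (hS.const_mem a) with h | h
  · obtain ⟨t, ht1, ht2⟩ := (h2.and_eventually h).exists
    linarith
  · obtain ⟨t, ht1, ht2⟩ := (h1.and_eventually h).exists
    linarith

lemma tendsto_trichotomy (hf : f ∈ S) :
    (∃ c, Tendsto f atTop (nhds c)) ∨ Tendsto f atTop atTop ∨ Tendsto (-f) atTop atTop := by
  rcases hS.eventually_le_const_or_tendsto_atTop hf with ⟨n, hn⟩ | h
  · rcases hS.eventually_le_const_or_tendsto_atTop (S.neg_mem hf) with ⟨m, hm⟩ | h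
    · refine Or.inl (hS.exists_tendsto_of_bounded hf (A := -m) (B := n) ?_ hn)
      filter_upwards [hm] with t ht
      have : -f t ≤ m := ht
      linarith
    · exact Or.inr (Or.inr h)
  · exact Or.inr (Or.inl h)

/-- Upper bounds by powers may be differentiated: otherwise `f'` would exceed every multiple of
`t ^ k`, and `f` every multiple of `t ^ (k + 1)`. -/
lemma exists_eventually_deriv_le (hf : f ∈ S) {k : ℕ} {C : ℝ}
    (h : ∀ᶠ t in atTop, f t ≤ C * t ^ (k + 1)) :
    ∃ C' : ℝ, ∀ᶠ t in atTop, deriv f t ≤ C' * t ^ k := by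
  obtain ⟨M, hM⟩ := exists_nat_gt C
  refine ⟨(M * (k + 1) : ℕ), ?_⟩
  have hmem : (fun t : ℝ => ((M * (k + 1) : ℕ) : ℝ) * t ^ k) ∈ S :=
    S.mul_mem (hS.natCast_mem _) (S.pow_mem hS.id_mem k)
  refine (hS.eventually_le_or_le (hS.deriv_mem f hf) hmem).resolve_right fun hge => ?_
  have hder : ∀ᶠ t : ℝ in atTop,
      HasDerivAt (fun t : ℝ => M * t ^ (k + 1)) (((M * (k + 1) : ℕ) : ℝ) * t ^ k) t :=
    Eventually.of_forall fun t => by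
      have := (hasDerivAt_pow (k + 1) t).const_mul (M : ℝ)
      refine this.congr_deriv ?_
      rw [Nat.add_sub_cancel]; push_cast; ring
  obtain ⟨B, hB⟩ := exists_eventually_le_add_of_deriv_le hder (hS.eventually_hasDerivAt hf) hge
  have hlim : Tendsto (fun t : ℝ => (M - C) * t ^ (k + 1)) atTop atTop :=
    (tendsto_pow_atTop (Nat.succ_ne_zero k)).const_mul_atTop (by linarith)
  obtain ⟨t, h1, h2, h3⟩ := (h.and (hB.and (hlim.eventually_gt_atTop B))).exists
  nlinarith

lemma exists_tendsto_iterate_deriv (hf : f ∈ S) {k : ℕ} {C : ℝ}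
    (h₁ : ∀ᶠ t in atTop, f t ≤ C * t ^ k) (h₂ : ∀ᶠ t in atTop, -f t ≤ C * t ^ k) :
    ∃ c, Tendsto (deriv^[k] f) atTop (nhds c) := by
  induction k generalizing f C with
  | zero =>
    refine hS.exists_tendsto_of_bounded hf (A := -C) (B := C) ?_ ?_
    · filter_upwards [h₂] with t ht
      simp only [pow_zero, mul_one] at ht
      exact neg_le.1 ht
    · simpa using h₁
  | succ k ih =>
    obtain ⟨C₁, hC₁⟩ := hS.exists_eventually_deriv_le hf h₁
    obtain ⟨C₂, hC₂⟩ := hS.exists_eventually_deriv_le (S.neg_mem hf) h₂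
    rw [Function.iterate_succ]
    refine ih (hS.deriv_mem f hf) (C := max C₁ C₂) ?_ ?_
    · filter_upwards [hC₁, eventually_ge_atTop 0] with t ht h0
      exact ht.trans (by gcongr; exact le_max_left _ _)
    · filter_upwards [hC₂, eventually_ge_atTop 0] with t ht h0
      rw [deriv.neg] at ht
      exact ht.trans (by gcongr; exact le_max_right _ _)

omit hS in
lemma eventually_hasDerivAt_const_mul_log (C : ℝ) :
    ∀ᶠ t : ℝ in atTop, HasDerivAt (fun t => C * Real.log t) (C / t) t := by
  filter_upwards [eventually_gt_atTop 0] with t ht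
  simpa [div_eq_mul_inv] using (Real.hasDerivAt_log ht.ne').const_mul C

lemma id_mul_deriv_mem (hf : f ∈ S) : (fun t => t * deriv f t) ∈ S :=
  S.mul_mem hS.id_mem (hS.deriv_mem f hf)

lemma log_isLittleO_of_tendsto (hf : f ∈ S) (h : Tendsto (fun t => t * deriv f t) atTop atTop) :
    Real.log =o[atTop] fun t => |f t| := by
  rw [isLittleO_iff]
  intro c hc
  have h1 : ∀ᶠ t : ℝ in atTop, 2 / c / t ≤ deriv f t := by
    filter_upwards [h.eventually_ge_atTop (2 / c), eventually_gt_atTop 0] with t ht h0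
    rw [div_le_iff₀ h0]
    linarith
  obtain ⟨B, hB⟩ := exists_eventually_le_add_of_deriv_le
    (eventually_hasDerivAt_const_mul_log (2 / c)) (hS.eventually_hasDerivAt hf) h1
  filter_upwards [hB, Real.tendsto_log_atTop.eventually_ge_atTop (max 0 (c * B))] with t ht hlog
  rw [max_le_iff] at hlog
  rw [Real.norm_of_nonneg hlog.1, Real.norm_eq_abs, abs_abs]
  have h2 : 2 * Real.log t ≤ c * (f t + B) := by
    have := mul_le_mul_of_nonneg_left ht hc.le
    rwa [← mul_assoc, mul_div_cancel₀ _ hc.ne'] at this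
  have h3 := mul_le_mul_of_nonneg_left (le_abs_self (f t)) hc.le
  linarith

/-- An element of a Hardy ring either grows faster than the logarithm, or varies as slowly
as the logarithm. -/
lemma log_isLittleO_or_bounded (hf : f ∈ S) :
    (Real.log =o[atTop] fun t => |f t|) ∨ ∃ C : ℝ, ∀ᶠ t in atTop, |t * deriv f t| ≤ C := by
  have hf' := S.neg_mem hf
  rcases hS.eventually_le_const_or_tendsto_atTop (hS.id_mul_deriv_mem hf) with ⟨n, hn⟩ | h
  · rcases hS.eventually_le_const_or_tendsto_atTop (hS.id_mul_deriv_mem hf') with ⟨m, hm⟩ | h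
    · refine Or.inr ⟨max n m, ?_⟩
      filter_upwards [hn, hm] with t h1 h2
      rw [deriv.neg] at h2
      refine abs_le.2 ⟨?_, h1.trans (le_max_left _ _)⟩
      have := le_max_right (n : ℝ) m
      linarith
    · have := hS.log_isLittleO_of_tendsto hf' h
      simp only [Pi.neg_apply, abs_neg] at this
      exact Or.inl this
  · exact Or.inl (hS.log_isLittleO_of_tendsto hf h)

/-- Elements of a Hardy ring satisfy this form of l'Hôpital's rule: if `t * f'` were bounded above,
`f` would be bounded by a multiple of the logarithm. -/
lemma tendsto_mul_deriv_of_log_isLittleO (hf : f ∈ S) (hlim : Tendsto f atTop atTop)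
    (h : Real.log =o[atTop] fun t => |f t|) :
    Tendsto (fun t => t * deriv f t) atTop atTop := by
  refine (hS.eventually_le_const_or_tendsto_atTop (hS.id_mul_deriv_mem hf)).resolve_left ?_
  rintro ⟨n, hn⟩
  have h1 : ∀ᶠ t : ℝ in atTop, deriv f t ≤ (n : ℝ) / t := by
    filter_upwards [hn, eventually_gt_atTop 0] with t ht h0
    rw [le_div_iff₀ h0]
    linarith
  obtain ⟨B, hB⟩ := exists_eventually_le_add_of_deriv_le (hS.eventually_hasDerivAt hf)
    (eventually_hasDerivAt_const_mul_log n) h1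
  have hc : (0 : ℝ) < 1 / (2 * (n + 1)) := by positivity
  obtain ⟨t, h2, h3, h4, h5⟩ := (hB.and ((isLittleO_iff.1 h hc).and
    ((hlim.eventually_gt_atTop (2 * B)).and (hlim.eventually_gt_atTop 0)))).exists
  rw [Real.norm_eq_abs, Real.norm_eq_abs, abs_abs, abs_of_pos h5] at h3
  have h6 : Real.log t ≤ 1 / (2 * (n + 1)) * f t := (le_abs_self _).trans h3
  have h7 : n * Real.log t ≤ f t / 2 := by
    have := mul_le_mul_of_nonneg_left h6 (Nat.cast_nonneg n)
    refine this.trans ?_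
    rw [← mul_assoc, mul_one_div, div_mul_eq_mul_div, div_le_div_iff₀ (by positivity) two_pos]
    nlinarith
  linarith

end IsHardyRing

/-! ### Differences of elements of a Hardy ring -/

/-- The mean value theorem for iterated differences. -/
lemma exists_fwdDiff_iterate_eq {k : ℕ} {g : ℕ → ℝ → ℝ} {T : ℝ}
    (h : ∀ j < k, ∀ t, T ≤ t → HasDerivAt (g j) (g (j + 1) t) t) :
    ∀ t, T ≤ t → ∃ ξ ∈ Set.Icc t (t + k), (Δ_[1])^[k] (g 0) t = g k ξ := by
  induction k generalizing g with
  | zero => exact fun t _ => ⟨t, by simp, rfl⟩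
  | succ k ih =>
    intro t ht
    obtain ⟨ξ, hξ, he⟩ := ih (g := fun j => Δ_[1] (g j)) (fun j hj s hs => by
      have h1 := (h j (by omega) (s + 1) (by linarith)).comp_add_const s 1
      exact h1.sub (h j (by omega) s hs)) t ht
    have hder : ∀ s, ξ ≤ s → HasDerivAt (g k) (g (k + 1) s) s := fun s hs =>
      h k (Nat.lt_succ_self k) s (ht.trans (hξ.1.trans hs))
    obtain ⟨η, hη, hslope⟩ := exists_hasDerivAt_eq_slope (g k) (g (k + 1)) (lt_add_one ξ)
      (fun s hs => (hder s hs.1).continuousAt.continuousWithinAt)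
      fun s hs => hder s hs.1.le
    refine ⟨η, ⟨hξ.1.trans hη.1.le, ?_⟩, ?_⟩
    · have := hξ.2
      have := hη.2
      push_cast
      linarith
    · rw [Function.iterate_succ_apply, he, hslope]
      simp [fwdDiff]

lemma fwdDiff_iterate_natCast (f : ℝ → ℝ) (k n : ℕ) :
    (Δ_[1])^[k] (fun n : ℕ => f n) n = (Δ_[1])^[k] f (n : ℝ) := by
  induction k generalizing n with
  | zero => rfl
  | succ k ih =>
    rw [Function.iterate_succ_apply', Function.iterate_succ_apply', fwdDiff, fwdDiff, ih, ih]
    push_cast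
    rfl

lemma eventually_forall_ge {p : ℝ → Prop} (h : ∀ᶠ t in atTop, p t) :
    ∀ᶠ n : ℕ in atTop, ∀ t, (n : ℝ) ≤ t → p t := by
  obtain ⟨T, hT⟩ := exists_forall_ge_of_eventually h
  filter_upwards [tendsto_natCast_atTop_atTop.eventually_ge_atTop T] with n hn t ht
  exact hT t (hn.trans ht)

namespace IsHardyRing

variable {S : Subring (ℝ → ℝ)} (hS : IsHardyRing S) {f g : ℝ → ℝ}

include hS

lemma eventually_fwdDiff_eq (hf : f ∈ S) (k : ℕ) :
    ∀ᶠ n : ℕ in atTop, ∃ ξ ∈ Set.Icc (n : ℝ) (n + k),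
      (Δ_[1])^[k] (fun n : ℕ => f n) n = deriv^[k] f ξ := by
  have h : ∀ᶠ t in atTop, ∀ j ∈ Finset.range k,
      HasDerivAt (deriv^[j] f) (deriv^[j + 1] f t) t := by
    rw [eventually_all_finset]
    intro j _
    rw [Function.iterate_succ']
    exact hS.eventually_hasDerivAt (hS.iterate_deriv_mem hf j)
  filter_upwards [eventually_forall_ge h] with n hn
  rw [fwdDiff_iterate_natCast]
  exact exists_fwdDiff_iterate_eq (g := fun j => deriv^[j] f)
    (fun j hj t ht => hn t ht j (Finset.mem_range.2 hj)) n le_rfl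

lemma tendsto_fwdDiff_iterate (hf : f ∈ S) {k : ℕ} {c : ℝ}
    (h : Tendsto (deriv^[k] f) atTop (nhds c)) :
    Tendsto ((Δ_[1])^[k] (fun n : ℕ => f n)) atTop (nhds c) := by
  refine tendsto_def.2 fun U hU => ?_
  filter_upwards [hS.eventually_fwdDiff_eq hf k, eventually_forall_ge (h hU)]
    with n ⟨ξ, hξ, he⟩ hn
  rw [Set.mem_preimage, he]
  exact hn ξ hξ.1

lemma hasMeanZero_of_tendsto_irrational (hf : f ∈ S) {k : ℕ} (hk : 1 ≤ k) {c : ℝ}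
    (hc : Irrational c) (h : Tendsto (deriv^[k] f) atTop (nhds c)) :
    HasMeanZero fun n : ℕ => ex (f n) :=
  hasMeanZero_of_tendsto_iterate_fwdDiff hk (hS.tendsto_fwdDiff_iterate hf h) hc

lemma eventually_deriv_pos (hf : f ∈ S) (h : Tendsto f atTop atTop) :
    ∀ᶠ t in atTop, 0 < deriv f t := by
  have hle : ¬ ∀ᶠ t in atTop, deriv f t ≤ 0 := by
    intro hle
    obtain ⟨B, hB⟩ := exists_eventually_le_add_of_deriv_le (hS.eventually_hasDerivAt hf)
      (Eventually.of_forall fun t => hasDerivAt_const t (0 : ℝ)) hle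
    obtain ⟨t, h1, h2⟩ := (hB.and (h.eventually_gt_atTop B)).exists
    linarith
  rcases hS.signed _ (hS.deriv_mem f hf) with h | h | h
  · exact absurd (h.mono fun t ht => ht.le) hle
  · exact h
  · exact absurd (h.mono fun t ht => ht.le) hle

lemma eventually_deriv_nonpos (hg : g ∈ S) (hpos : ∀ᶠ t in atTop, 0 < g t)
    (hlim : Tendsto g atTop (nhds 0)) : ∀ᶠ t in atTop, deriv g t ≤ 0 := by
  rcases hS.signed _ (hS.deriv_mem g hg) with h | h | h
  · exact h.mono fun t ht => ht.le
  · exfalso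
    obtain ⟨T, hT⟩ := exists_forall_ge_of_eventually (hpos.and (h.and (hS.differentiable g hg)))
    have hmono : MonotoneOn g (Set.Ici T) := by
      refine monotoneOn_of_deriv_nonneg (convex_Ici T)
        (fun t ht => (hT t ht).2.2.continuousAt.continuousWithinAt)
        (fun t ht => ?_) fun t ht => ?_
      · rw [interior_Ici] at ht
        exact (hT t (le_of_lt ht)).2.2.differentiableWithinAt
      · rw [interior_Ici] at ht
        exact (hT t (le_of_lt ht)).2.1.le
    have h1 : g T ≤ 0 := ge_of_tendsto hlim (by
      filter_upwards [eventually_ge_atTop T] with t ht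
      exact hmono Set.self_mem_Ici ht ht)
    linarith [(hT T le_rfl).1]
  · exact h.mono fun t ht => ht.le

/-- If the `k`-th derivative decreases to zero, then so do the `k`-th differences, and the
derivative at `n` and at `n + k` bounds the difference at `n`. -/
lemma eventually_fwdDiff_bounds (hf : f ∈ S) {k : ℕ}
    (hpos : ∀ᶠ t in atTop, 0 < deriv^[k] f t)
    (hlim : Tendsto (deriv^[k] f) atTop (nhds 0)) :
    ∀ᶠ n : ℕ in atTop,
      (Δ_[1])^[k] (fun n : ℕ => f n) (n + 1) ≤ (Δ_[1])^[k] (fun n : ℕ => f n) n ∧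
      deriv^[k] f (n + k) ≤ (Δ_[1])^[k] (fun n : ℕ => f n) n ∧
      (Δ_[1])^[k] (fun n : ℕ => f n) n ≤ deriv^[k] f n := by
  have hmem := hS.iterate_deriv_mem hf k
  have hder := hS.eventually_deriv_nonpos hmem hpos hlim
  filter_upwards [hS.eventually_fwdDiff_eq hf k, hS.eventually_fwdDiff_eq hf (k + 1),
    eventually_forall_ge (hder.and (hS.differentiable _ hmem))] with n ⟨ξ, hξ, he⟩ ⟨η, hη, he'⟩ hn
  have hanti : AntitoneOn (deriv^[k] f) (Set.Ici (n : ℝ)) := by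
    refine antitoneOn_of_deriv_nonpos (convex_Ici _)
      (fun t ht => (hn t ht).2.continuousAt.continuousWithinAt)
      (fun t ht => ?_) fun t ht => ?_
    · rw [interior_Ici] at ht
      exact (hn t (le_of_lt ht)).2.differentiableWithinAt
    · rw [interior_Ici] at ht
      exact (hn t (le_of_lt ht)).1
  refine ⟨?_, ?_, ?_⟩
  · rw [Function.iterate_succ_apply', Function.iterate_succ_apply'] at he'
    have := (hn η hη.1).1
    rw [fwdDiff] at he'
    linarith
  · rw [he]
    exact hanti hξ.1 (Set.mem_Ici.2 (by linarith [Nat.cast_nonneg (α := ℝ) k])) hξ.2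
  · rw [he]
    exact hanti Set.self_mem_Ici hξ.1 hξ.1

lemma isFejer_fwdDiff (hf : f ∈ S) {k : ℕ}
    (hlim : Tendsto (deriv^[k] f) atTop (nhds 0))
    (h : Tendsto (fun t => t * deriv^[k] f t) atTop atTop) :
    IsFejer ((Δ_[1])^[k] (fun n : ℕ => f n)) := by
  have hpos : ∀ᶠ t in atTop, 0 < deriv^[k] f t := by
    filter_upwards [h.eventually_gt_atTop 0, eventually_gt_atTop 0] with t ht h0
    exact pos_of_mul_pos_right ht h0.le
  have hb := hS.eventually_fwdDiff_bounds hf hpos hlim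
  refine ⟨hb.mono fun n hn => hn.1, hS.tendsto_fwdDiff_iterate hf hlim, ?_⟩
  have hnk : Tendsto (fun n : ℕ => (n : ℝ) + k) atTop atTop :=
    tendsto_atTop_add_const_right _ _ tendsto_natCast_atTop_atTop
  have h1 : Tendsto (fun n : ℕ => ((n : ℝ) + k) * deriv^[k] f (n + k) - k * deriv^[k] f (n + k))
      atTop atTop := by
    refine (h.comp hnk).atTop_add (C := k * (-0 : ℝ))
      (g := fun n : ℕ => k * -deriv^[k] f (n + k)) ?_ |>.congr fun n => ?_
    · exact ((hlim.comp hnk).neg).const_mul _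
    · simp [sub_eq_add_neg]
  refine tendsto_atTop_mono' _ ?_ h1
  filter_upwards [hb] with n hn
  have := mul_le_mul_of_nonneg_left hn.2.1 (Nat.cast_nonneg (α := ℝ) n)
  linarith

end IsHardyRing

/-! ### Rational polynomials -/

open Polynomial in
/-- Modulo `1`, the values of a rational polynomial at natural numbers are periodic. -/
lemma exists_aeval_add_mul_eq (p : ℚ[X]) :
    ∃ q : ℕ, 0 < q ∧ ∀ n m : ℕ, ∃ z : ℤ,
      aeval ((n + q * m : ℕ) : ℝ) p = aeval (n : ℝ) p + z := by
  induction p using Polynomial.induction_on' with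
  | add p₁ p₂ h₁ h₂ =>
    obtain ⟨q₁, hq₁, h₁⟩ := h₁
    obtain ⟨q₂, hq₂, h₂⟩ := h₂
    refine ⟨q₁ * q₂, Nat.mul_pos hq₁ hq₂, fun n m => ?_⟩
    obtain ⟨z₁, hz₁⟩ := h₁ n (q₂ * m)
    obtain ⟨z₂, hz₂⟩ := h₂ n (q₁ * m)
    refine ⟨z₁ + z₂, ?_⟩
    rw [map_add, map_add, mul_assoc, hz₁, ← mul_assoc, mul_comm q₁ q₂, mul_assoc, hz₂]
    push_cast; ring
  | monomial i c =>
    refine ⟨c.den, c.den_pos, fun n m => ?_⟩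
    obtain ⟨d, hd⟩ := sub_dvd_pow_sub_pow ((n : ℤ) + c.den * m) n i
    refine ⟨c.num * (m * d), ?_⟩
    have hd' : ((n : ℝ) + c.den * m) ^ i - (n : ℝ) ^ i = (c.den * m) * d := by
      have : (((n : ℤ) + c.den * m) ^ i - (n : ℤ) ^ i : ℤ) = (c.den * m) * d := by
        rw [hd]; ring
      exact_mod_cast this
    have hc : (c : ℝ) * c.den = c.num := by exact_mod_cast Rat.mul_den_eq_num c
    rw [aeval_monomial, aeval_monomial]
    push_cast
    rw [← hc]
    simp only [eq_ratCast]
    linear_combination (c : ℝ) * hd'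

open Polynomial in
lemma exists_periodic_ex_aeval (p : ℚ[X]) :
    ∃ q : ℕ, 0 < q ∧ Function.Periodic (fun n : ℕ => ex (aeval (n : ℝ) p)) q := by
  obtain ⟨q, hq, h⟩ := exists_aeval_add_mul_eq p
  refine ⟨q, hq, fun n => ?_⟩
  obtain ⟨z, hz⟩ := h n 1
  rw [mul_one] at hz
  simp only [hz, ex_add, ex_int, mul_one]

open Polynomial in
lemma iterate_deriv_aeval (p : ℚ[X]) (k : ℕ) :
    deriv^[k] (fun t : ℝ => aeval t p) = fun t : ℝ => aeval t (derivative^[k] p) := by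
  induction k generalizing p with
  | zero => rfl
  | succ k ih =>
    have : deriv (fun t : ℝ => aeval t p) = fun t : ℝ => aeval t (derivative p) := by
      funext t; exact Polynomial.deriv_aeval p
    rw [Function.iterate_succ_apply, this, ih, Function.iterate_succ_apply]

lemma eventuallyEq_iterate_deriv {f g : ℝ → ℝ} (h : f =ᶠ[atTop] g) (k : ℕ) :
    deriv^[k] f =ᶠ[atTop] deriv^[k] g := by
  induction k with
  | zero => exact h
  | succ k ih =>
    obtain ⟨T, hT⟩ := exists_forall_ge_of_eventually ih
    rw [Function.iterate_succ_apply', Function.iterate_succ_apply']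
    filter_upwards [eventually_gt_atTop T] with t ht
    refine EventuallyEq.deriv_eq ?_
    filter_upwards [Ioi_mem_nhds ht] with s hs using hT s (le_of_lt hs)

lemma HasMeanZero.congr {u v : ℕ → ℂ} (h : HasMeanZero u) (huv : ∀ n, u n = v n) :
    HasMeanZero v := by
  rwa [← funext huv]

lemma HasMeanZero.conj {u : ℕ → ℂ} (h : HasMeanZero u) : HasMeanZero fun n => conj (u n) := by
  unfold HasMeanZero at *
  simp only [← map_sum]
  rw [← isLittleO_norm_left] at h ⊢
  simpa only [RCLike.norm_conj] using h

namespace IsHardyRing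

variable {S : Subring (ℝ → ℝ)} (hS : IsHardyRing S) {f g : ℝ → ℝ}

include hS

lemma iterate_deriv_add (hf : f ∈ S) (hg : g ∈ S) (k : ℕ) :
    deriv^[k] (f + g) =ᶠ[atTop] deriv^[k] f + deriv^[k] g := by
  induction k generalizing f g with
  | zero => exact EventuallyEq.rfl
  | succ k ih =>
    have h1 : deriv (f + g) =ᶠ[atTop] deriv f + deriv g := by
      filter_upwards [hS.differentiable f hf, hS.differentiable g hg] with t h1 h2
      exact deriv_add h1 h2
    simp only [Function.iterate_succ_apply]
    exact (eventuallyEq_iterate_deriv h1 k).trans (ih (hS.deriv_mem f hf) (hS.deriv_mem g hg))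

open Polynomial in
lemma aeval_mem (p : ℚ[X]) : (fun t : ℝ => aeval t p) ∈ S := by
  induction p using Polynomial.induction_on' with
  | add p₁ p₂ h₁ h₂ =>
    simp only [map_add]
    exact S.add_mem h₁ h₂
  | monomial i c =>
    have : (fun t : ℝ => aeval t (monomial i c)) = fun t : ℝ => (c : ℝ) * t ^ i := by
      funext t; rw [aeval_monomial]; rfl
    rw [this]
    exact S.mul_mem (hS.const_mem c) (S.pow_mem hS.id_mem i)

open Polynomial in
lemma iterate_deriv_add_aeval (hf : f ∈ S) (p : ℚ[X]) (k : ℕ) :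
    deriv^[k] (f + fun t : ℝ => aeval t p)
      =ᶠ[atTop] fun t => deriv^[k] f t + aeval t (derivative^[k] p) := by
  have := hS.iterate_deriv_add hf (hS.aeval_mem p) k
  rw [iterate_deriv_aeval] at this
  exact this

/-! ### Exponential sums of elements of a Hardy ring -/

/-- An unbounded element of a Hardy ring with derivative `g` cannot satisfy `g ≤ t ^ (-9/8)`
eventually, because the right hand side is integrable. -/
lemma eventually_le_deriv (hg : g ∈ S) (h : Tendsto g atTop atTop) :
    ∀ᶠ t : ℝ in atTop, t ^ (-(9 / 8) : ℝ) ≤ deriv g t := by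
  have hpos := hS.eventually_deriv_pos hg h
  have hmem : (fun t : ℝ => t ^ 9 * deriv g t ^ 8) ∈ S :=
    S.mul_mem (S.pow_mem hS.id_mem 9) (S.pow_mem (hS.deriv_mem g hg) 8)
  have hpow : ∀ t : ℝ, 0 < t → (t ^ (-(9 / 8) : ℝ)) ^ 8 = (t ^ 9)⁻¹ := by
    intro t ht
    rw [← Real.rpow_natCast, ← Real.rpow_mul ht.le, ← Real.rpow_natCast t 9,
      ← Real.rpow_neg ht.le]
    norm_num
  rcases hS.eventually_le_or_le hmem (hS.natCast_mem 1) with hle | hle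
  · exfalso
    have h1 : ∀ᶠ t : ℝ in atTop, deriv g t ≤ t ^ (-(9 / 8) : ℝ) := by
      filter_upwards [hle, eventually_gt_atTop 0, hpos] with t ht h0 hp
      rw [← pow_le_pow_iff_left₀ hp.le (by positivity) (by norm_num : (8 : ℕ) ≠ 0), hpow t h0,
        le_inv_comm₀ (by positivity) (by positivity), ← one_div, le_div_iff₀ (by positivity)]
      simpa using ht
    have hder : ∀ᶠ t : ℝ in atTop,
        HasDerivAt (fun t : ℝ => (-8) * t ^ (-(1 / 8) : ℝ)) (t ^ (-(9 / 8) : ℝ)) t := by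
      filter_upwards [eventually_gt_atTop 0] with t h0
      have := (Real.hasDerivAt_rpow_const (p := -(1 / 8)) (Or.inl h0.ne')).const_mul (-8)
      refine this.congr_deriv ?_
      rw [← mul_assoc]
      norm_num
    obtain ⟨B, hB⟩ := exists_eventually_le_add_of_deriv_le (hS.eventually_hasDerivAt hg) hder h1
    obtain ⟨t, h2, h3, h4⟩ :=
      (hB.and ((h.eventually_gt_atTop B).and (eventually_gt_atTop 0))).exists
    have : 0 < t ^ (-(1 / 8) : ℝ) := Real.rpow_pos_of_pos h4 _
    linarith
  · filter_upwards [hle, eventually_gt_atTop 0, hpos] with t ht h0 hp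
    rw [← pow_le_pow_iff_left₀ (by positivity) hp.le (by norm_num : (8 : ℕ) ≠ 0), hpow t h0,
      inv_le_iff_one_le_mul₀ (by positivity), mul_comm]
    simpa using ht

/-- Let `g` be the `(k + 1)`-st derivative of `f`. Either `g` is at least `t ^ (-3/4)`, which is
more than Fejér's condition requires, or `g` lies between `t ^ (-9/8)` and `t ^ (-3/4)`. -/
lemma hasMeanZero_of_tendsto_atTop (hf : f ∈ S) {k : ℕ} (hk : 1 ≤ k)
    (htop : Tendsto (deriv^[k] f) atTop atTop)
    (hlim : Tendsto (deriv^[k + 1] f) atTop (nhds 0)) : HasMeanZero fun n : ℕ => ex (f n) := by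
  have hpos : ∀ᶠ t in atTop, 0 < deriv^[k + 1] f t := by
    rw [Function.iterate_succ']
    exact hS.eventually_deriv_pos (hS.iterate_deriv_mem hf k) htop
  have hlow : ∀ᶠ t : ℝ in atTop, t ^ (-(9 / 8) : ℝ) ≤ deriv^[k + 1] f t := by
    rw [Function.iterate_succ']
    exact hS.eventually_le_deriv (hS.iterate_deriv_mem hf k) htop
  have hmem : (fun t : ℝ => t ^ 3 * deriv^[k + 1] f t ^ 4) ∈ S :=
    S.mul_mem (S.pow_mem hS.id_mem 3) (S.pow_mem (hS.iterate_deriv_mem hf (k + 1)) 4)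
  rcases hS.eventually_le_or_le hmem (hS.natCast_mem 1) with hle | hle
  · refine hasMeanZero_of_isIntermediate_iterate_fwdDiff (k := k + 1) (by omega)
      ⟨2 ^ (-(9 / 8) : ℝ), 1, by positivity, ?_⟩
    -- the lower bound is taken at `n + (k + 1) ≤ 2 * n`, whence the constant
    have hup : ∀ᶠ t : ℝ in atTop, deriv^[k + 1] f t ≤ t ^ (-(3 / 4) : ℝ) := by
      filter_upwards [hle, eventually_gt_atTop 0, hpos] with t ht h0 hp
      have hpow : (t ^ (-(3 / 4) : ℝ)) ^ 4 = (t ^ 3)⁻¹ := by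
        rw [← Real.rpow_natCast, ← Real.rpow_mul h0.le, ← Real.rpow_natCast t 3,
          ← Real.rpow_neg h0.le]
        norm_num
      rw [← pow_le_pow_iff_left₀ hp.le (by positivity) (by norm_num : (4 : ℕ) ≠ 0), hpow,
        le_inv_comm₀ (by positivity) (by positivity), ← one_div, le_div_iff₀ (by positivity)]
      simpa using ht
    filter_upwards [hS.eventually_fwdDiff_bounds hf hpos hlim, eventually_forall_ge (hlow.and hup),
      eventually_ge_atTop (k + 1)] with n hn hb hnk
    have hn0 : (0 : ℝ) < n := by exact_mod_cast (by omega : 0 < n)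
    have hnk' : ((k + 1 : ℕ) : ℝ) ≤ n := by exact_mod_cast hnk
    refine ⟨hn.1, ?_, ?_⟩
    · refine le_trans ?_ ((hb (n + (k + 1 : ℕ)) (by linarith)).1.trans hn.2.1)
      rw [← Real.mul_rpow (by norm_num) hn0.le]
      exact Real.rpow_le_rpow_of_nonpos (by positivity) (by linarith) (by norm_num)
    · rw [one_mul]
      exact hn.2.2.trans (hb n le_rfl).2
  · refine hasMeanZero_of_isFejer_iterate_fwdDiff (k := k + 1) (by omega)
      (hS.isFejer_fwdDiff hf hlim (tendsto_atTop.2 fun b => ?_))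
    filter_upwards [hle, eventually_ge_atTop (max b 1 ^ 4), eventually_gt_atTop 0, hpos]
      with t ht hb h0 hp
    have h1 : max b 1 ^ 4 ≤ (t * deriv^[k + 1] f t) ^ 4 := by
      have h2 : (t * deriv^[k + 1] f t) ^ 4 = t * (t ^ 3 * deriv^[k + 1] f t ^ 4) := by ring
      rw [h2]
      have h3 : (1 : ℝ) ≤ t ^ 3 * deriv^[k + 1] f t ^ 4 := by simpa using ht
      nlinarith
    rw [pow_le_pow_iff_left₀ (by positivity) (by positivity) (by norm_num)] at h1
    exact (le_max_left b 1).trans h1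

lemma hasMeanZero_of_log_isLittleO (hf : f ∈ S) (htop : Tendsto f atTop atTop)
    (hlim : Tendsto (deriv f) atTop (nhds 0)) (hlog : Real.log =o[atTop] fun t => |f t|) :
    HasMeanZero fun n : ℕ => ex (f n) :=
  hasMeanZero_of_isFejer_iterate_fwdDiff le_rfl (hS.isFejer_fwdDiff hf (k := 1) hlim
    (hS.tendsto_mul_deriv_of_log_isLittleO hf htop hlog))

/-- A twist by a linear phase does not affect derivatives of order at least two. For `k = 0` it
makes the first derivative tend to `ρ`, so that Fejér's condition is needed only for `ρ ∈ ℤ`. -/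
lemma hasMeanZero_twist_of_tendsto_atTop (hf : f ∈ S) {k : ℕ}
    (htop : Tendsto (deriv^[k] f) atTop atTop)
    (hlim : Tendsto (deriv^[k + 1] f) atTop (nhds 0)) (hlog : Real.log =o[atTop] fun t => |f t|)
    (ρ : ℚ) : HasMeanZero fun n : ℕ => ex (ρ * n) * ex (f n) := by
  set p : Polynomial ℚ := Polynomial.C ρ * Polynomial.X with hp
  have hmem : (f + fun t : ℝ => Polynomial.aeval t p) ∈ S := S.add_mem hf (hS.aeval_mem p)
  have hfun : (fun n : ℕ => ex (ρ * n) * ex (f n))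
      = fun n : ℕ => ex ((f + fun t : ℝ => Polynomial.aeval t p) n) := by
    funext n
    rw [← ex_add, add_comm]
    simp [hp]
  have hd : ∀ j : ℕ, Polynomial.derivative^[j + 2] p = 0 := by
    intro j
    rw [Function.iterate_add_apply]
    simp [hp]
  rcases Nat.eq_zero_or_pos k with rfl | hk
  · by_cases hz : ∃ z : ℤ, (ρ : ℝ) = z
    · obtain ⟨z, hz⟩ := hz
      have : ∀ n : ℕ, ex (ρ * n) = 1 := by
        intro n
        rw [hz]
        exact_mod_cast ex_int (z * n)
      simp only [this, one_mul]
      exact hS.hasMeanZero_of_log_isLittleO hf htop hlim hlog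
    · rw [hfun]
      refine hasMeanZero_of_tendsto_fwdDiff (β := ρ)
        (hS.tendsto_fwdDiff_iterate hmem (k := 1) ?_) fun z h => hz ⟨z, h⟩
      refine Tendsto.congr' (hS.iterate_deriv_add_aeval hf p 1).symm ?_
      simpa [hp] using hlim.add_const (ρ : ℝ)
  · rw [hfun]
    refine hS.hasMeanZero_of_tendsto_atTop hmem hk ?_ ?_
    · refine Tendsto.congr' (hS.iterate_deriv_add_aeval hf p k).symm ?_
      obtain ⟨j, rfl⟩ : ∃ j, k = j + 1 := ⟨k - 1, by omega⟩
      rcases Nat.eq_zero_or_pos j with rfl | hj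
      · simpa [hp] using tendsto_atTop_add_const_right _ (ρ : ℝ) htop
      · obtain ⟨i, rfl⟩ : ∃ i, j = i + 1 := ⟨j - 1, by omega⟩
        simpa only [hd, map_zero, add_zero] using htop
    · refine Tendsto.congr' (hS.iterate_deriv_add_aeval hf p (k + 1)).symm ?_
      obtain ⟨j, rfl⟩ : ∃ j, k = j + 1 := ⟨k - 1, by omega⟩
      simpa only [hd, map_zero, add_zero] using hlim

lemma hasMeanZero_twist_of_tendsto_irrational (hf : f ∈ S) {k : ℕ} {c : ℝ} (hc : Irrational c)
    (hlim : Tendsto (deriv^[k + 1] f) atTop (nhds c)) (ρ : ℚ) :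
    HasMeanZero fun n : ℕ => ex (ρ * n) * ex (f n) := by
  set p : Polynomial ℚ := Polynomial.C ρ * Polynomial.X with hp
  have hmem : (f + fun t : ℝ => Polynomial.aeval t p) ∈ S := S.add_mem hf (hS.aeval_mem p)
  have hfun : (fun n : ℕ => ex (ρ * n) * ex (f n))
      = fun n : ℕ => ex ((f + fun t : ℝ => Polynomial.aeval t p) n) := by
    funext n
    rw [← ex_add, add_comm]
    simp [hp]
  obtain ⟨r, hr⟩ : ∃ r : ℚ, Polynomial.derivative^[k + 1] p = Polynomial.C r := by
    rcases Nat.eq_zero_or_pos k with rfl | hk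
    · exact ⟨ρ, by simp [hp]⟩
    · obtain ⟨j, rfl⟩ : ∃ j, k = j + 1 := ⟨k - 1, by omega⟩
      refine ⟨0, ?_⟩
      rw [show j + 1 + 1 = j + 2 from rfl, Function.iterate_add_apply]
      simp [hp]
  rw [hfun]
  refine hS.hasMeanZero_of_tendsto_irrational hmem (k := k + 1) (by omega)
    (hc.add_ratCast r) ?_
  refine Tendsto.congr' (hS.iterate_deriv_add_aeval hf p (k + 1)).symm ?_
  rw [hr]
  simpa using hlim.add_const (r : ℝ)

/-- The exponential sums of an element of a Hardy ring that stays away from the rational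
polynomials, with periodic weights. A rational leading coefficient is absorbed into the weight. -/
lemma hasMeanZero_periodic_mul_ex (k : ℕ) : ∀ f ∈ S, (∃ c, Tendsto (deriv^[k] f) atTop (nhds c)) →
    (∀ p : Polynomial ℚ, Real.log =o[atTop] fun t => |f t - Polynomial.aeval t p|) →
    ∀ (w : ℕ → ℂ) (q : ℕ), 0 < q → Function.Periodic w q →
      HasMeanZero fun n : ℕ => w n * ex (f n) := by
  induction k with
  | zero =>
    rintro f - ⟨c, hc⟩ hlog
    exfalso
    have h0 := hlog 0
    simp only [map_zero, sub_zero] at h0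
    have h1 : Real.log =o[atTop] fun _ : ℝ => (1 : ℝ) :=
      h0.trans_isBigO (hc.abs.isBigO_one ℝ)
    rw [isLittleO_one_iff] at h1
    exact not_tendsto_nhds_of_tendsto_atTop Real.tendsto_log_atTop 0 h1
  | succ k ih =>
    rintro f hf ⟨c, hc⟩ hlog w q hq hw
    by_cases hirr : Irrational c
    · exact hasMeanZero_periodic_mul
        (fun ρ => hS.hasMeanZero_twist_of_tendsto_irrational hf hirr hc ρ) hq hw
    obtain ⟨r, rfl⟩ : ∃ r : ℚ, (r : ℝ) = c := by
      simpa [Irrational] using hirr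
    set p : Polynomial ℚ :=
      Polynomial.C (r / (k + 1).factorial) * Polynomial.X ^ (k + 1) with hp
    have hder : Polynomial.derivative^[k + 1] (-p) = Polynomial.C (-r) := by
      have hfac : ((k + 1).factorial : ℚ) ≠ 0 := by positivity
      rw [Polynomial.iterate_derivative_neg, hp, Polynomial.iterate_derivative_C_mul,
        Polynomial.iterate_derivative_X_pow_eq_natCast_mul, Nat.descFactorial_self, Nat.sub_self,
        pow_zero, mul_one, ← Polynomial.C_eq_natCast, ← Polynomial.C_mul, div_mul_cancel₀ _ hfac,
        Polynomial.C_neg]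
    set g : ℝ → ℝ := f + fun t : ℝ => Polynomial.aeval t (-p) with hgdef
    have hg : g ∈ S := S.add_mem hf (hS.aeval_mem _)
    have hglim : Tendsto (deriv^[k + 1] g) atTop (nhds 0) := by
      refine Tendsto.congr' (hS.iterate_deriv_add_aeval hf (-p) (k + 1)).symm ?_
      rw [hder]
      simpa using hc.add_const (-r : ℝ)
    have hglog : ∀ p' : Polynomial ℚ,
        Real.log =o[atTop] fun t => |g t - Polynomial.aeval t p'| := by
      intro p'
      refine (hlog (p + p')).congr_right fun t => ?_
      simp only [hgdef, Pi.add_apply, map_neg, map_add]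
      congr 1
      ring
    have hgz : Real.log =o[atTop] fun t => |g t| := by simpa using hglog 0
    have key : ∀ (w : ℕ → ℂ) (q : ℕ), 0 < q → Function.Periodic w q →
        HasMeanZero fun n : ℕ => w n * ex (g n) := by
      rcases hS.tendsto_trichotomy (hS.iterate_deriv_mem hg k) with h | h | h
      · exact ih g hg h hglog
      · intro w q hq hw
        exact hasMeanZero_periodic_mul
          (fun ρ => hS.hasMeanZero_twist_of_tendsto_atTop hg h hglim hgz ρ) hq hw
      · intro w q hq hw
        refine hasMeanZero_periodic_mul (fun ρ => ?_) hq hw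
        rw [← iterate_deriv_neg] at h
        have := (hS.hasMeanZero_twist_of_tendsto_atTop (S.neg_mem hg) h
          (by have := hglim.neg; rw [neg_zero] at this; rwa [iterate_deriv_neg])
          (by simpa only [Pi.neg_apply, abs_neg] using hgz) (-ρ)).conj
        refine this.congr fun n => ?_
        simp only [map_mul, conj_ex, Pi.neg_apply, neg_neg]
        congr 2
        push_cast; ring
    obtain ⟨q', hq', hper⟩ := exists_periodic_ex_aeval p
    have hw' : Function.Periodic (fun n : ℕ => w n * ex (Polynomial.aeval (n : ℝ) p)) (q * q') := by
      have h1 : Function.Periodic w (q * q') := by rw [mul_comm]; exact hw.nat_mul q'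
      exact h1.mul (hper.nat_mul q)
    refine (key _ (q * q') (Nat.mul_pos hq hq') hw').congr fun n => ?_
    rw [mul_assoc, ← ex_add]
    simp [hgdef]

end IsHardyRing

/-! ### Equidistribution excludes slowly varying sequences -/

lemma dist_coe_le (x y : ℝ) : dist (x : UnitAddCircle) (y : UnitAddCircle) ≤ |x - y| := by
  rw [dist_eq_norm, ← AddCircle.coe_sub, UnitAddCircle.norm_eq]
  simpa using round_le (x - y) 0

/-- A tent function on the circle, supported in the arc of radius `r` around `x₀`. -/
noncomputable def tent (x₀ : UnitAddCircle) (r : ℝ) (x : UnitAddCircle) : ℝ :=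
  max 0 (1 - dist x x₀ / r)

lemma continuous_tent (x₀ : UnitAddCircle) (r : ℝ) : Continuous (tent x₀ r) := by
  unfold tent; fun_prop

lemma tent_nonneg (x₀ : UnitAddCircle) (r : ℝ) (x : UnitAddCircle) : 0 ≤ tent x₀ r x :=
  le_max_left _ _

lemma half_le_tent {x₀ x : UnitAddCircle} {r : ℝ} (hr : 0 < r) (h : dist x x₀ ≤ r / 2) :
    1 / 2 ≤ tent x₀ r x := by
  refine le_trans ?_ (le_max_right _ _)
  have : dist x x₀ / r ≤ 1 / 2 := by rw [div_le_iff₀ hr]; linarith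
  linarith

lemma integral_tent_le (x₀ : UnitAddCircle) {r : ℝ} (hr : 0 < r) :
    ∫ x, tent x₀ r x ∂(AddCircle.haarAddCircle : MeasureTheory.Measure UnitAddCircle) ≤ 2 * r := by
  have hvol : (AddCircle.haarAddCircle : MeasureTheory.Measure UnitAddCircle)
      = MeasureTheory.volume := by
    rw [AddCircle.volume_eq_smul_haarAddCircle, ENNReal.ofReal_one, one_smul]
  have hle : ∀ x, tent x₀ r x ≤ (Metric.closedBall x₀ r).indicator (fun _ => (1 : ℝ)) x := by
    intro x
    by_cases hx : x ∈ Metric.closedBall x₀ r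
    · rw [Set.indicator_of_mem hx]
      exact max_le zero_le_one (by linarith [div_nonneg (dist_nonneg (x := x) (y := x₀)) hr.le])
    · rw [Set.indicator_of_notMem hx]
      rw [Metric.mem_closedBall, not_le] at hx
      have : 1 ≤ dist x x₀ / r := by rw [le_div_iff₀ hr]; linarith
      exact max_le le_rfl (by linarith)
  have hball : MeasurableSet (Metric.closedBall x₀ r) := Metric.isClosed_closedBall.measurableSet
  calc ∫ x, tent x₀ r x ∂(AddCircle.haarAddCircle : MeasureTheory.Measure UnitAddCircle)
      ≤ ∫ x, (Metric.closedBall x₀ r).indicator (fun _ => (1 : ℝ)) x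
          ∂(AddCircle.haarAddCircle : MeasureTheory.Measure UnitAddCircle) := by
        refine MeasureTheory.integral_mono ?_ ?_ hle
        · exact (continuous_tent x₀ r).integrable_of_hasCompactSupport
            (HasCompactSupport.of_compactSpace _)
        · exact (MeasureTheory.integrable_const 1).indicator hball
    _ ≤ 2 * r := by
        rw [MeasureTheory.integral_indicator_const _ hball, smul_eq_mul, mul_one, hvol,
          MeasureTheory.measureReal_def, AddCircle.volume_closedBall,
          ENNReal.toReal_ofReal (by positivity)]
        exact min_le_right _ _

/-- For an equidistributed sequence, the averages of a continuous function over the blocks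
`(s * K, (s + 1) * K]` converge to its integral. -/
lemma tendsto_block_average {x : ℕ → UnitAddCircle}
    (hx : IsEquidistributed x (AddCircle.haarAddCircle : MeasureTheory.Measure UnitAddCircle))
    {F : UnitAddCircle → ℝ} (hF : Continuous F) {s : ℕ} (hs : 0 < s) :
    Tendsto (fun K : ℕ => (∑ n ∈ Finset.Ioc (s * K) ((s + 1) * K), F (x n)) / K) atTop
      (nhds (∫ t, F t ∂(AddCircle.haarAddCircle : MeasureTheory.Measure UnitAddCircle))) := by
  set I := ∫ t, F t ∂(AddCircle.haarAddCircle : MeasureTheory.Measure UnitAddCircle) with hI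
  have havg : Tendsto (fun N : ℕ => (∑ n ∈ Finset.Icc 1 N, F (x n)) / N) atTop (nhds I) := by
    have h1 := hx ⟨fun t => (F t : ℂ), by fun_prop⟩
    have h2 := (Complex.continuous_re.tendsto _).comp h1
    simp only [ContinuousMap.coe_mk, integral_complex_ofReal, Complex.ofReal_re] at h2
    refine h2.congr fun N => ?_
    rw [Function.comp_apply, ← Complex.ofReal_sum, ← Complex.ofReal_natCast, ← Complex.ofReal_one,
      ← Complex.ofReal_div, ← Complex.ofReal_mul, Complex.ofReal_re]
    ring
  have hmul : ∀ c : ℕ, 0 < c → Tendsto (fun K : ℕ => c * K) atTop atTop := fun c hc =>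
    tendsto_id.const_mul_atTop' hc
  have h1 := ((havg.comp (hmul (s + 1) (by omega))).const_mul ((s : ℝ) + 1)).sub
    ((havg.comp (hmul s hs)).const_mul (s : ℝ))
  have h2 : ((s : ℝ) + 1) * I - s * I = I := by ring
  rw [h2] at h1
  refine h1.congr' ?_
  filter_upwards [eventually_gt_atTop 0] with K hK
  have hK' : (K : ℝ) ≠ 0 := by positivity
  have hs' : (s : ℝ) ≠ 0 := by positivity
  have hs1 : (s : ℝ) + 1 ≠ 0 := by positivity
  have hsplit : ∑ n ∈ Finset.Icc 1 ((s + 1) * K), F (x n)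
      = ∑ n ∈ Finset.Icc 1 (s * K), F (x n) + ∑ n ∈ Finset.Ioc (s * K) ((s + 1) * K), F (x n) := by
    have e : ∀ N, Finset.Icc 1 N = Finset.Ioc 0 N := fun N => rfl
    rw [e, e, Finset.sum_Ioc_consecutive _ (Nat.zero_le _) (Nat.mul_le_mul_right K (Nat.le_succ s))]
  simp only [Function.comp_apply]
  rw [hsplit]
  push_cast
  field_simp
  ring

lemma abs_sub_le_of_abs_mul_deriv_le {f : ℝ → ℝ} {C T : ℝ} (hT : 0 < T)
    (h : ∀ t, T ≤ t → DifferentiableAt ℝ f t ∧ |t * deriv f t| ≤ C) {u : ℝ} (hu : T ≤ u) :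
    |f u - f T| ≤ C / T * (u - T) := by
  have := (convex_Ici T).norm_image_sub_le_of_norm_deriv_le (f := f) (C := C / T)
    (fun t ht => (h t ht).1) (fun t ht => ?_) (Set.self_mem_Ici (a := T)) hu
  · rwa [Real.norm_eq_abs, Real.norm_eq_abs, abs_of_nonneg (sub_nonneg.2 hu)] at this
  · have ht' : T ≤ t := ht
    have h1 := (h t ht).2
    rw [abs_mul, abs_of_pos (hT.trans_le ht')] at h1
    rw [Real.norm_eq_abs, le_div_iff₀ hT]
    have := mul_le_mul_of_nonneg_right ht' (abs_nonneg (deriv f t))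
    linarith

/-- If `a` differs from a rational polynomial by a function that varies no faster than the
logarithm, then `a n` modulo `1` is nearly constant on the multiples of a fixed `q` in a block
`(s * K, (s + 1) * K]`; this is too large a proportion of the block to be in a short arc. -/
lemma not_isEquidistributed_of_abs_mul_deriv_le {a : ℝ → ℝ} {p : Polynomial ℚ} {C : ℝ}
    (hd : ∀ᶠ t in atTop, DifferentiableAt ℝ (fun t => a t - Polynomial.aeval t p) t)
    (hC : ∀ᶠ t in atTop, |t * deriv (fun t => a t - Polynomial.aeval t p) t| ≤ C) :
    ¬ IsEquidistributed (fun n : ℕ => ((a (n : ℝ) : ℝ) : UnitAddCircle))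
      (AddCircle.haarAddCircle : MeasureTheory.Measure UnitAddCircle) := by
  intro hequi
  set f : ℝ → ℝ := fun t => a t - Polynomial.aeval t p with hf
  obtain ⟨q, hq, hper⟩ := exists_aeval_add_mul_eq p
  have hq' : (0 : ℝ) < q := by exact_mod_cast hq
  -- the tent has integral at most `2 * r`, which is less than `1 / 2 * (1 / q)`, its height on the
  -- multiples of `q` times their density
  set r : ℝ := 1 / (8 * q) with hr
  have hr0 : 0 < r := by positivity
  -- `f` varies by at most `C / s` over a block
  obtain ⟨s, hs⟩ := exists_nat_gt (max 0 (C / (r / 4)))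
  rw [max_lt_iff] at hs
  have hspos : 0 < s := by exact_mod_cast hs.1
  have hCs : C / s ≤ r / 4 := by
    have := hs.2
    rw [div_lt_iff₀ (by positivity)] at this
    rw [div_le_iff₀ hs.1]
    linarith
  -- a limit point of the positions at the left ends of the blocks
  obtain ⟨x₀, -, φ, hφ, hlim⟩ := (isCompact_univ (X := UnitAddCircle)).tendsto_subseq
    (x := fun m : ℕ => ((f (s * (q * m : ℕ)) + Polynomial.aeval (0 : ℝ) p : ℝ) : UnitAddCircle))
    (fun _ => Set.mem_univ _)
  have hK : Tendsto (fun i => q * φ i) atTop atTop :=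
    (tendsto_id.const_mul_atTop' hq).comp hφ.tendsto_atTop
  have hblock := (tendsto_block_average hequi (continuous_tent x₀ r) hspos).comp hK
  have hlower : ∀ᶠ i in atTop, 1 / (2 * q) ≤
      (∑ n ∈ Finset.Ioc (s * (q * φ i)) ((s + 1) * (q * φ i)),
        tent x₀ r ((a (n : ℝ) : ℝ) : UnitAddCircle)) / (q * φ i : ℕ) := by
    have hleft : Tendsto (fun i => (s : ℝ) * (q * φ i : ℕ)) atTop atTop :=
      (tendsto_natCast_atTop_atTop.comp hK).const_mul_atTop hs.1
    obtain ⟨T, hT⟩ := exists_forall_ge_of_eventually (hd.and hC)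
    filter_upwards [hφ.tendsto_atTop.eventually_gt_atTop 0, hleft.eventually_ge_atTop T,
      hlim.eventually (Metric.closedBall_mem_nhds x₀ (by positivity : 0 < r / 4))]
      with i hi hiT hdist
    set m := φ i with hm
    have hm' : (0 : ℝ) < m := by exact_mod_cast hi
    have hKpos : (0 : ℝ) < (q * m : ℕ) := by push_cast; positivity
    have hval : ∀ j ∈ Finset.Ioc (s * m) ((s + 1) * m),
        1 / 2 ≤ tent x₀ r ((a ((q * j : ℕ) : ℝ) : ℝ) : UnitAddCircle) := by
      intro j hj
      rw [Finset.mem_Ioc] at hj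
      apply half_le_tent hr0
      obtain ⟨z, hz⟩ := hper 0 j
      rw [zero_add, Nat.cast_zero] at hz
      have h1 : a ((q * j : ℕ) : ℝ) = f (q * j : ℕ) + Polynomial.aeval (0 : ℝ) p + z := by
        simp only [hf]; rw [hz]; ring
      have h2 : ((a ((q * j : ℕ) : ℝ) : ℝ) : UnitAddCircle)
          = ((f (q * j : ℕ) + Polynomial.aeval (0 : ℝ) p : ℝ) : UnitAddCircle) := by
        have hz0 : ((z : ℝ) : UnitAddCircle) = 0 := by
          rw [AddCircle.coe_eq_zero_iff]; exact ⟨z, by simp⟩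
        rw [h1, AddCircle.coe_add, hz0, add_zero]
      have hj1 : (s : ℝ) * m ≤ j := by exact_mod_cast hj.1.le
      have hj2 : (j : ℝ) ≤ (s + 1) * m := by exact_mod_cast hj.2
      have h3 : |f (q * j : ℕ) - f (s * (q * m : ℕ))| ≤ r / 4 := by
        refine (abs_sub_le_of_abs_mul_deriv_le (mul_pos hs.1 hKpos)
          (fun t ht => hT t (hiT.trans ht)) ?_).trans ?_
        · push_cast; nlinarith
        · have hC0 : 0 ≤ C := (abs_nonneg _).trans (hT _ le_rfl).2
          calc C / (s * (q * m : ℕ)) * ((q * j : ℕ) - s * (q * m : ℕ))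
              ≤ C / (s * (q * m : ℕ)) * (q * m : ℕ) := by
                gcongr
                push_cast; nlinarith
            _ = C / s := by field_simp
            _ ≤ r / 4 := hCs
      rw [h2]
      refine (dist_triangle _ ((f (s * (q * m : ℕ)) + Polynomial.aeval (0 : ℝ) p : ℝ) :
        UnitAddCircle) _).trans ?_
      have h4 := dist_coe_le (f (q * j : ℕ) + Polynomial.aeval (0 : ℝ) p)
        (f (s * (q * m : ℕ)) + Polynomial.aeval (0 : ℝ) p)
      rw [add_sub_add_right_eq_sub] at h4
      have h5 := Metric.mem_closedBall.1 hdist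
      simp only [Function.comp_apply] at h5
      linarith
    have hsub : (Finset.Ioc (s * m) ((s + 1) * m)).image (fun j => q * j)
        ⊆ Finset.Ioc (s * (q * m)) ((s + 1) * (q * m)) := by
      intro n hn
      obtain ⟨j, hj, rfl⟩ := Finset.mem_image.1 hn
      rw [Finset.mem_Ioc] at hj ⊢
      rw [Nat.mul_left_comm s q m, Nat.mul_left_comm (s + 1) q m]
      exact ⟨Nat.mul_lt_mul_of_pos_left hj.1 hq, Nat.mul_le_mul_left q hj.2⟩
    have hsum : (m : ℝ) * (1 / 2) ≤ ∑ n ∈ Finset.Ioc (s * (q * m)) ((s + 1) * (q * m)),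
        tent x₀ r ((a (n : ℝ) : ℝ) : UnitAddCircle) := by
      refine le_trans ?_ (Finset.sum_le_sum_of_subset_of_nonneg hsub
        fun _ _ _ => tent_nonneg _ _ _)
      rw [Finset.sum_image fun x _ y _ h => Nat.eq_of_mul_eq_mul_left hq h]
      refine le_trans (le_of_eq ?_) (Finset.sum_le_sum hval)
      rw [Finset.sum_const, Nat.card_Ioc, nsmul_eq_mul]
      congr 2
      rw [Nat.add_mul, one_mul, Nat.add_sub_cancel_left]
    rw [le_div_iff₀ hKpos]
    refine le_trans (le_of_eq ?_) hsum
    push_cast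
    field_simp
  have h1 := ge_of_tendsto hblock hlower
  have h2 := h1.trans (integral_tent_le x₀ hr0)
  have h3 : 2 * r = 1 / (2 * q) / 2 := by rw [hr]; field_simp; ring
  have h4 : 0 < 1 / (2 * (q : ℝ)) := by positivity
  linarith

end HardyEquidistribution

open HardyEquidistribution

theorem theorem3p1 (a : ℝ → ℝ) (ha : IsHardyFunction a) (hgrowth : HasPolynomialGrowth a) :
    IsEquidistributed (fun n : ℕ => ((a (n : ℝ) : ℝ) : UnitAddCircle))
        (AddCircle.haarAddCircle : MeasureTheory.Measure UnitAddCircle) ↔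
      ∀ p : Polynomial ℚ,
        (fun t : ℝ => Real.log t) =o[atTop] (fun t : ℝ => |a t - Polynomial.aeval t p|) := by
  obtain ⟨S, hS, haS⟩ := exists_isHardyRing ha
  constructor
  · intro hequi p
    have hmem : (fun t : ℝ => a t - Polynomial.aeval t p) ∈ S := S.sub_mem haS (hS.aeval_mem p)
    refine (hS.log_isLittleO_or_bounded hmem).resolve_right ?_
    rintro ⟨C, hC⟩
    exact not_isEquidistributed_of_abs_mul_deriv_le (hS.differentiable _ hmem) hC hequi
  · intro hlog
    obtain ⟨d, hd⟩ := hgrowth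
    refine isEquidistributed_of_hasMeanZero (x := fun n : ℕ => a n) fun k hk => ?_
    have hk' : (k : ℝ) ≠ 0 := by exact_mod_cast hk
    set f : ℝ → ℝ := fun t => k * a t with hf
    have hfS : f ∈ S := S.mul_mem (by simpa using hS.const_mem k) haS
    have hgrow : ∀ᶠ t : ℝ in atTop, |f t| ≤ 1 * t ^ d := by
      filter_upwards [isLittleO_iff.1 (hd.const_mul_left (k : ℝ)) zero_lt_one,
        eventually_ge_atTop 0] with t ht h0
      rwa [Real.norm_eq_abs, Real.norm_eq_abs, abs_of_nonneg (pow_nonneg h0 d)] at ht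
    have hlogf : ∀ p : Polynomial ℚ,
        Real.log =o[atTop] fun t => |f t - Polynomial.aeval t p| := by
      intro p
      have h1 := (hlog (Polynomial.C ((k : ℚ)⁻¹) * p)).const_mul_right (c := |(k : ℝ)|)
        (abs_ne_zero.2 hk')
      refine h1.congr_right fun t => ?_
      rw [← abs_mul, mul_sub, map_mul, Polynomial.aeval_C]
      congr 2
      rw [← mul_assoc]
      simp [hk']
    have := hS.hasMeanZero_periodic_mul_ex d f hfS
      (hS.exists_tendsto_iterate_deriv hfS (hgrow.mono fun t ht => (le_abs_self _).trans ht)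
        (hgrow.mono fun t ht => (neg_le_abs _).trans ht)) hlogf (fun _ => 1) 1 one_pos
      (fun _ => rfl)
    simpa only [one_mul] using this
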